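/- **Setting.** Let $(x,v,D,\theta)\in\mathbb R^3\times\mathbb T$ carry the Hamiltonian equations $\dot x=\partial_vK$, $\dot v=-\partial_xK$, $\dot\theta=\partial_DK$, $\dot D=-\partial_\theta K$. An integrable two-degree-of-freedom Hamiltonian is a function $h(x,v,D)$ independent of $\theta$, and a one-parameter family of them is a function $H_0(x,v,D;c)$. A *circle of parabolic fixed points* of $h$ is a circle $\{(x,v,D)\}\times\mathbb T$ all of whose points are fixed points of the flow of $h$ and at which $\det\frac{\partial^2h}{\partial(x,v)^2}=0$. For an open set $U$, $C^\infty(U)$ carries the topology of uniform convergence of all derivatives on compact subsets of $U$; a subset is called *generic* if it is residual (contains a countable intersection of open dense sets) and dense. For $H_0\in C^\infty(U)$, $U\subset\mathbb R^4$ open with coordinates $(x,v,D,c)$, put $$F=\{\nabla_{(x,v)}H_0=0\},\qquad P=\{q\in F:\det\tfrac{\partial^2H_0}{\partial(x,v)^2}(q)=0\},\qquad T=\{\partial_DH_0=0\}.$$ A point $q\in P\cap T$ is called *transverse* if the differentials at $q$ of $(\nabla_{(x,v)}H_0,\det\frac{\partial^2H_0}{\partial(x,v)^2})$ and of $\partial_DH_0$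 are onto $\mathbb R^3$ and $\mathbb R$ respectively, and $P$ and $T$ are transverse at $q$ (their tangent spaces span $\mathbb R^4$). **Lemma 3.** The occurrence of a circle of parabolic fixed points is generic in one-parameter families of integrable two-degree-of-freedom Hamiltonians, i.e. it is a codimension-one phenomenon. Precisely, let $U\subset\mathbb R^4$ and $\Omega\subset\mathbb R^3$ be open. 1. For every $H_0\in C^\infty(U)$ and $(x,v,D,c)\in U$, $\{(x,v,D)\}\times\mathbb T$ is a circle of parabolic fixed points of $H_0(\cdot\,;c)$ if and only if $(x,v,D,c)\in P\cap T$. 2. For generic $H_0\in C^\infty(U)$: $F$ is a two-dimensional surface, $P\subset F$ is a one-dimensional curve, and $T$ is a three-dimensional surface (smooth submanifolds, possibly empty), each cut out regularly by its defining equations; $\frac{\partial^2H_0}{\partial(x,v)^2}\neq0$ on $P$; $P$ and $T$ intersect transversally at every point $q_{PR}\in P\cap T$; the points of $P\cap T$ are isolated, and each compact subset of $U$ contains only finitely many of them. 3. For every $q\in U$ there is $H_0\in C^\infty(U)$ having $q$ as a transverse point of $P\cap T$. 4. Transverse points persist: if $q$ is a transverse point of $P\cap T$ for $H_0$, then every neighbourhood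 of $q$ contains a neighbourhood $W$ of $q$ such that every $H_0'\in C^\infty(U)$ sufficiently close to $H_0$ has exactly one point of its own $P'\cap T'$ in $W$, and that point is transverse. 5. In contrast, a generic single Hamiltonian $h\in C^\infty(\Omega)$, $\Omega\subset\mathbb R^3$ with coordinates $(x,v,D)$, has no circle of parabolic fixed points in $\Omega\times\mathbb T$. -/

import Mathlib

open Set Filter Topology
open scoped ContDiff

/-- Real functions on `ℝⁿ` that are `C^∞` on `U` (the values off `U` play no role). -/
def SmoothFn {n : ℕ} (U : Set (Fin n → ℝ)) : Type :=
  {f : (Fin n → ℝ) → ℝ // ContDiffOn ℝ ∞ f U}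

namespace SmoothFn

variable {n : ℕ} {U : Set (Fin n → ℝ)}

instance : CoeFun (SmoothFn U) (fun _ => (Fin n → ℝ) → ℝ) := ⟨fun f => f.1⟩

/-- The `C^∞` topology: uniform convergence on the compact subsets of `U` of all derivatives,
of every order `k = 0, 1, 2, …`. -/
noncomputable instance : TopologicalSpace (SmoothFn U) :=
  ⨅ k : ℕ, TopologicalSpace.induced
    (fun f : SmoothFn U =>
      UniformOnFun.ofFun {K : Set (Fin n → ℝ) | IsCompact K ∧ K ⊆ U}
        (fun q => iteratedFDeriv ℝ k f.1 q))
    inferInstance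

end SmoothFn

/-- A generic set: residual (it contains a countable intersection of open dense sets) and dense. -/
def IsGeneric {X : Type*} [TopologicalSpace X] (S : Set X) : Prop :=
  S ∈ residual X ∧ Dense S

/-- The partial derivative in the `i`-th coordinate. -/
noncomputable def pd {n : ℕ} (i : Fin n) (f : (Fin n → ℝ) → ℝ) (q : Fin n → ℝ) : ℝ :=
  fderiv ℝ f q (Pi.single i 1)

/-- The Hessian matrix in the first two coordinates `(x, v)`. -/
noncomputable def normalHess {n : ℕ} (f : (Fin (n + 2) → ℝ) → ℝ) (q : Fin (n + 2) → ℝ) :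
    Matrix (Fin 2) (Fin 2) ℝ :=
  !![pd 0 (pd 0 f) q, pd 1 (pd 0 f) q;
     pd 0 (pd 1 f) q, pd 1 (pd 1 f) q]

/-- `S ⊆ ℝⁿ` is a smooth (embedded) submanifold of dimension `k`: near each of its points it is the
zero set of a smooth submersion onto `ℝ^(n-k)`. -/
def IsSubmanifold {n : ℕ} (k : ℕ) (S : Set (Fin n → ℝ)) : Prop :=
  ∃ m : ℕ, k + m = n ∧ ∀ p ∈ S, ∃ W : Set (Fin n → ℝ), IsOpen W ∧ p ∈ W ∧
    ∃ g : (Fin n → ℝ) → (Fin m → ℝ), ContDiffOn ℝ ∞ g W ∧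
      (∀ q ∈ W, Function.Surjective (fderiv ℝ g q)) ∧ S ∩ W = {q ∈ W | g q = 0}

/-- The tangent space of `S` at `p`: the span of the velocities at `p` of curves in `S`. -/
def tangentSpaceOf {n : ℕ} (S : Set (Fin n → ℝ)) (p : Fin n → ℝ) : Submodule ℝ (Fin n → ℝ) :=
  Submodule.span ℝ {w | ∃ γ : ℝ → (Fin n → ℝ),
    γ 0 = p ∧ (∀ᶠ t in 𝓝 (0 : ℝ), γ t ∈ S) ∧ HasDerivAt γ w 0}

/-- Transversality of two subsets at a common point: their tangent spaces there span `ℝⁿ`. -/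
def TransverseAt {n : ℕ} (S S' : Set (Fin n → ℝ)) (p : Fin n → ℝ) : Prop :=
  tangentSpaceOf S p ⊔ tangentSpaceOf S' p = ⊤

/-! ### A single integrable system, in the phase space `ℝ³ × 𝕋` with coordinates
`(x, v, D) = (y 0, y 1, y 2)` and the angle `θ` conjugate to `D` -/

/-- The Hamiltonian vector field `(ẋ, v̇, Ḋ, θ̇) = (∂K/∂v, -∂K/∂x, -∂K/∂θ, ∂K/∂D)` of a function
`K(x, v, D, θ)`. -/
noncomputable def hamVF (K : (Fin 3 → ℝ) × Real.Angle → ℝ) (p : (Fin 3 → ℝ) × Real.Angle) :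
    Fin 4 → ℝ :=
  ![pd 1 (fun y => K (y, p.2)) p.1,
    -pd 0 (fun y => K (y, p.2)) p.1,
    -deriv (fun t : ℝ => K (p.1, p.2 + (t : Real.Angle))) 0,
    pd 2 (fun y => K (y, p.2)) p.1]

/-- The circle `{y} × 𝕋` is a circle of parabolic fixed points of the integrable Hamiltonian
`h(x, v, D)`: each of its points is an equilibrium of the flow on `ℝ³ × 𝕋`, and the fixed point of
the `(x, v)`-flow is parabolic. -/
def IsParabolicCircle (h : (Fin 3 → ℝ) → ℝ) (y : Fin 3 → ℝ) : Prop :=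
  (∀ θ : Real.Angle, hamVF (fun p => h p.1) (y, θ) = 0) ∧ (normalHess h y).det = 0

/-! ### One-parameter families, in the space of `(x, v, D, c) = (q 0, q 1, q 2, q 3)` -/

/-- The point `(x, v, D, c)`. -/
def withParam (y : Fin 3 → ℝ) (c : ℝ) : Fin 4 → ℝ := ![y 0, y 1, y 2, c]

/-- The left-hand side `∇_(x,v) H` of the equation of fixed points of the `(x, v)`-flow. -/
noncomputable def fixEq (H : (Fin 4 → ℝ) → ℝ) (q : Fin 4 → ℝ) : Fin 2 → ℝ :=
  ![pd 0 H q, pd 1 H q]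

/-- The left-hand sides `(∇_(x,v) H, det ∂²H/∂(x,v)²)` of the equations of parabolic points. -/
noncomputable def parEq (H : (Fin 4 → ℝ) → ℝ) (q : Fin 4 → ℝ) : Fin 3 → ℝ :=
  ![pd 0 H q, pd 1 H q, (normalHess (n := 2) H q).det]

/-- The fixed points `F` of the `(x, v)`-flow, in the domain `U`. -/
def fixedSet (U : Set (Fin 4 → ℝ)) (H : (Fin 4 → ℝ) → ℝ) : Set (Fin 4 → ℝ) :=
  {q ∈ U | fixEq H q = 0}

/-- The parabolic points `P ⊆ F`. -/
def parabolicSet (U : Set (Fin 4 → ℝ)) (H : (Fin 4 → ℝ) → ℝ) : Set (Fin 4 → ℝ) :=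
  {q ∈ fixedSet U H | (normalHess (n := 2) H q).det = 0}

/-- The set `T` where `dθ/dt = ∂H/∂D` vanishes. -/
def restSet (U : Set (Fin 4 → ℝ)) (H : (Fin 4 → ℝ) → ℝ) : Set (Fin 4 → ℝ) :=
  {q ∈ U | pd 2 H q = 0}

/-- At `q ∈ P ∩ T` the curve `P` (inside the surface `F`) and the hypersurface `T` are cut out
regularly by their equations, and `P` is transverse to `T`. -/
structure IsTransverseParabolicPoint (U : Set (Fin 4 → ℝ)) (H : (Fin 4 → ℝ) → ℝ)
    (q : Fin 4 → ℝ) : Prop where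
  mem_P : q ∈ parabolicSet U H
  mem_T : q ∈ restSet U H
  regular_P : Function.Surjective (fderiv ℝ (parEq H) q)
  regular_T : fderiv ℝ (pd 2 H) q ≠ 0
  transverse : TransverseAt (parabolicSet U H) (restSet U H) q

/-- The generic picture for a family `H` on `U`. -/
structure IsTransverseFamily (U : Set (Fin 4 → ℝ)) (H : (Fin 4 → ℝ) → ℝ) : Prop where
  surface_F : IsSubmanifold 2 (fixedSet U H)
  regular_F : ∀ q ∈ fixedSet U H, Function.Surjective (fderiv ℝ (fixEq H) q)
  curve_P : IsSubmanifold 1 (parabolicSet U H)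
  regular_P : ∀ q ∈ parabolicSet U H, Function.Surjective (fderiv ℝ (parEq H) q)
  hess_P : ∀ q ∈ parabolicSet U H, normalHess (n := 2) H q ≠ 0
  hypersurface_T : IsSubmanifold 3 (restSet U H)
  regular_T : ∀ q ∈ restSet U H, fderiv ℝ (pd 2 H) q ≠ 0
  transverse : ∀ q ∈ parabolicSet U H ∩ restSet U H,
    TransverseAt (parabolicSet U H) (restSet U H) q
  isolated : ∀ q ∈ parabolicSet U H ∩ restSet U H,
    ∃ W ∈ 𝓝 q, W ∩ (parabolicSet U H ∩ restSet U H) = {q}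
  finite_of_compact : ∀ K : Set (Fin 4 → ℝ), IsCompact K → K ⊆ U →
    (K ∩ (parabolicSet U H ∩ restSet U H)).Finite

/-! The theorem is a count of equations against unknowns, made rigorous by explicit perturbations. A
parabolic circle satisfies four equations: two for the fixed point, one for the determinant, one for
the resting angle. A family has four unknowns, so solutions are generically isolated and
nondegenerate; a single system has three, so generically there are none.

Genericity is an elementary form of parametric transversality. The space of smooth functions is
Baire (`baireSpace`), so it suffices that each bad condition is closed in the pair (function, point)
and can be avoided by arbitrarily small perturbations (`mem_residual_of_perturb`). Perturb by `m`
fixed polynomials with coefficients `a`. In each case the bad condition at `q` can be solved for `a`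
as a smooth function `Ψ q` of the `n` coordinates of `q`. If `n < m`, the bad coefficients lie in an
image of too small Hausdorff dimension (`dense_compl_image_of_lt`); if `n = m`, they are critical
values of `Ψ`, which form a null set (`dense_setOf_det_fderiv_ne_zero`).

Along `P` one second derivative `∂ⱼ²H` is nonzero, since the gradient and Hessian in `(x, v)` vanish
together only under five equations. There the differential of `∂ⱼH` can be eliminated, and
dependence of the three differentials defining `P` splits into three conditions of five equations
each (`IsRegularChart.eq_zero_of_relation`).

On `P ∩ T`, being a transverse point is equivalent to injectivity of the differential of the
four-equation map `restEq`. Isolation then follows from the inverse function theorem, and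
persistence from a quantitative version of it (`exists_unique_zero_of_fderiv_near`). The fold `v² +
x³ + xc + D²` provides a transverse point. -/

namespace SmoothFn

/-! ### The `C^∞` topology and its Baire property. -/

variable {n : ℕ} {U : Set (Fin n → ℝ)}

theorem contDiffAt (hU : IsOpen U) (H : SmoothFn U) {q : Fin n → ℝ} (hq : q ∈ U) :
    ContDiffAt ℝ ∞ H q :=
  H.2.contDiffAt (hU.mem_nhds hq)

/-- The `k`-th derivative of `H` as a continuous map on `U`. -/
noncomputable def jet (hU : IsOpen U) (k : ℕ) (H : SmoothFn U) :
    C(U, (Fin n → ℝ) [×k]→L[ℝ] ℝ) where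
  toFun q := iteratedFDeriv ℝ k H q
  continuous_toFun := continuous_iff_continuousAt.2 fun q =>
    ((H.contDiffAt hU q.2).continuousAt_iteratedFDeriv
      (by exact_mod_cast le_top)).comp continuousAt_subtype_val

/-- All derivatives of `H`, as a family of continuous maps on `U`. -/
noncomputable def jets (hU : IsOpen U) (H : SmoothFn U) :
    ∀ k : ℕ, C(U, (Fin n → ℝ) [×k]→L[ℝ] ℝ) :=
  fun k => jet hU k H

/-- Stated for all filters below `𝓝 H`, so that two neighbourhood filters can be compared through
the filters below them. -/
theorem le_nhds_iff {l : Filter (SmoothFn U)} {H : SmoothFn U} :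
    l ≤ 𝓝 H ↔ ∀ k : ℕ, ∀ K : Set (Fin n → ℝ), IsCompact K → K ⊆ U →
      TendstoUniformlyOn (fun (G : SmoothFn U) q => iteratedFDeriv ℝ k G q)
        (fun q => iteratedFDeriv ℝ k H q) l K := by
  rw [nhds_iInf, le_iInf_iff]
  refine forall_congr' fun k => ?_
  rw [nhds_induced, ← tendsto_iff_comap]
  rw [UniformOnFun.tendsto_iff_tendstoUniformlyOn]
  exact ⟨fun h K hK hKU => h K ⟨hK, hKU⟩, fun h K hK => h K hK.1 hK.2⟩

theorem tendsto_jets_iff (hU : IsOpen U) {l : Filter (SmoothFn U)}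
    {g : ∀ k : ℕ, C(U, (Fin n → ℝ) [×k]→L[ℝ] ℝ)} :
    Tendsto (jets hU) l (𝓝 g) ↔ ∀ k : ℕ, ∀ K : Set U, IsCompact K →
      TendstoUniformlyOn (fun (G : SmoothFn U) (q : U) => iteratedFDeriv ℝ k G q) (g k) l K := by
  rw [tendsto_pi_nhds]
  refine forall_congr' fun k => ?_
  rw [ContinuousMap.tendsto_iff_forall_isCompact_tendstoUniformlyOn]
  rfl

/-- Compact subsets of the subtype `U` are the same as compact sets contained in `U`. Only inducing,
not injective in general: functions that differ off `U` have the same jets. -/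
theorem isInducing_jets (hU : IsOpen U) : IsInducing (jets hU) := by
  refine isInducing_iff_nhds.2 fun H => ?_
  have key : ∀ l : Filter (SmoothFn U), l ≤ 𝓝 H ↔ l ≤ comap (jets hU) (𝓝 (jets hU H)) := by
    intro l
    rw [le_nhds_iff, ← tendsto_iff_comap, tendsto_jets_iff]
    refine forall_congr' fun k => ⟨fun h K hK => ?_, fun h K hK hKU => ?_⟩
    · have := h (Subtype.val '' K) (hK.image continuous_subtype_val) (by simp)
      intro u hu
      filter_upwards [this u hu] with G hG q hq
      exact hG q ⟨q, hq, rfl⟩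
    · have := h (Subtype.val ⁻¹' K) (Topology.IsInducing.subtypeVal.isCompact_preimage' hK (by simpa))
      intro u hu
      filter_upwards [this u hu] with G hG q hq
      exact hG ⟨q, hKU hq⟩ hq
  exact le_antisymm ((key _).1 le_rfl) ((key _).2 le_rfl)

/-- Locally uniform limits commute with differentiation, so a limit of jets of smooth functions is
the Taylor series of its own zeroth term. -/
theorem isClosed_range_jets (hU : IsOpen U) : IsClosed (range (jets hU)) := by
  classical
  refine isClosed_of_closure_subset fun g hg => ?_
  set l := comap (jets hU) (𝓝 g)
  have hne : l.NeBot := by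
    rw [comap_neBot_iff_frequently]
    exact mem_closure_iff_frequently.1 hg
  have hl := (tendsto_jets_iff hU).1 (tendsto_comap : Tendsto (jets hU) l (𝓝 g))
  -- The limit family `g` lives on the subtype; extending by `0` off the open set `U` does not
  -- affect derivatives on `U`.
  set p : (Fin n → ℝ) → FormalMultilinearSeries ℝ (Fin n → ℝ) ℝ :=
    fun q k => if h : q ∈ U then g k ⟨q, h⟩ else 0 with hp
  have hpU : ∀ q (hq : q ∈ U) k, p q k = g k ⟨q, hq⟩ := fun q hq k => by simp [hp, hq]
  have hunif : ∀ k, TendstoLocallyUniformlyOn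
      (fun (G : SmoothFn U) q => iteratedFDeriv ℝ k G q) (fun q => p q k) l U := by
    intro k
    rw [tendstoLocallyUniformlyOn_iff_forall_isCompact hU]
    intro K hKU hK u hu
    have := hl k (Subtype.val ⁻¹' K)
      (Topology.IsInducing.subtypeVal.isCompact_preimage' hK (by simpa))
    filter_upwards [this u hu] with G hG q hq
    rw [hpU q (hKU hq)]
    exact hG ⟨q, hKU hq⟩ hq
  have hder : ∀ k, ∀ q ∈ U, HasFDerivAt (fun q => p q k) (p q (k + 1)).curryLeft q := by
    intro k q hq
    refine hasFDerivAt_of_tendstoLocallyUniformlyOn (l := l) (g' := fun q => (p q (k + 1)).curryLeft)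
      (f := fun (G : SmoothFn U) q => iteratedFDeriv ℝ k G q)
      (f' := fun (G : SmoothFn U) q => (iteratedFDeriv ℝ (k + 1) G q).curryLeft) hU ?_ ?_ ?_ hq
    · exact UniformContinuous.comp_tendstoLocallyUniformlyOn
        (continuousMultilinearCurryLeftEquiv ℝ (fun _ : Fin (k + 1) => Fin n → ℝ) ℝ).isometry.uniformContinuous
        (hunif (k + 1))
    · intro G x hx
      have := ((G.contDiffAt hU hx).differentiableAt_iteratedFDeriv (m := k)
        (by exact_mod_cast WithTop.coe_lt_top _)).hasFDerivAt
      rwa [fderiv_iteratedFDeriv] at this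
    · intro x hx
      exact (hunif k).tendsto_at hx
  have hT : HasFTaylorSeriesUpToOn ∞ (fun q => (p q 0).curry0) p U :=
    ⟨fun _ _ => rfl, fun m _ q hq => (hder m q hq).hasFDerivWithinAt,
      fun m _ q hq => (hder m q hq).continuousAt.continuousWithinAt⟩
  refine ⟨⟨_, hT.contDiffOn⟩, ?_⟩
  funext k
  ext1 q
  change iteratedFDeriv ℝ k _ _ = _
  rw [← iteratedFDerivWithin_of_isOpen k hU q.2,
    ← hT.eq_iteratedFDerivWithin_of_uniqueDiffOn (by exact_mod_cast le_top) hU.uniqueDiffOn q.2, hpU _ q.2]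

/-- Closed range makes the pulled-back uniformity complete, and it is countably generated because
there are countably many orders `k` and `U` is locally compact and σ-compact. The Baire theorem for
complete pseudometric spaces applies. -/
theorem baireSpace (hU : IsOpen U) : BaireSpace (SmoothFn U) := by
  have : LocallyCompactSpace U := hU.locallyCompactSpace
  -- Replacing the topology keeps the uniform structure definitionally compatible with the given
  -- one.
  let u : UniformSpace (SmoothFn U) :=
    (UniformSpace.comap (jets hU) inferInstance).replaceTopology (isInducing_jets hU).eq_induced
  have hu : IsUniformInducing (jets hU) := ⟨rfl⟩
  have : CompleteSpace (SmoothFn U) :=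
    (completeSpace_iff_isComplete_range hu).2 (isClosed_range_jets hU).isComplete
  have : (uniformity (SmoothFn U)).IsCountablyGenerated := by
    rw [← hu.comap_uniformity]
    infer_instance
  let _ := UniformSpace.pseudoMetricSpace (SmoothFn U)
  infer_instance

/-- Evaluation is jointly continuous because `U` is locally compact. This is what makes conditions
on pairs `(H, q)` closed. -/
theorem continuous_jet_eval (hU : IsOpen U) (k : ℕ) :
    Continuous fun z : SmoothFn U × U => iteratedFDeriv ℝ k z.1 z.2 := by
  have : LocallyCompactSpace U := hU.locallyCompactSpace
  have h : Continuous fun H : SmoothFn U => jet hU k H :=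
    (continuous_apply k).comp (isInducing_jets hU).continuous
  have := (h.comp continuous_fst).eval (continuous_snd : Continuous fun z : SmoothFn U × U => z.2)
  exact this

theorem continuous_of_jets (hU : IsOpen U) {X : Type*} [TopologicalSpace X] {Φ : X → SmoothFn U}
    (h : ∀ k, Continuous fun z : X × U => iteratedFDeriv ℝ k (Φ z.1) z.2) : Continuous Φ := by
  rw [(isInducing_jets hU).continuous_iff]
  exact continuous_pi fun k => ContinuousMap.continuous_of_continuous_uncurry _ (h k)

theorem continuous_eval (hU : IsOpen U) : Continuous fun z : SmoothFn U × U => z.1 z.2 := by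
  simpa [iteratedFDeriv_zero_eq_comp, Function.comp_def] using
    (continuousMultilinearCurryFin0 ℝ (Fin n → ℝ) ℝ).continuous.comp (continuous_jet_eval hU 0)

theorem _root_.ContDiffOn.pd_of_isOpen {f : (Fin n → ℝ) → ℝ} (hf : ContDiffOn ℝ ∞ f U) (hU : IsOpen U)
    (i : Fin n) : ContDiffOn ℝ ∞ (pd i f) U := by
  have := (hf.fderiv_of_isOpen hU (m := ∞) (by simp)).clm_apply
    (contDiffOn_const (c := (Pi.single i 1 : Fin n → ℝ)))
  exact this

/-- The partial derivative of a smooth function on `U`. -/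
noncomputable def diff (hU : IsOpen U) (i : Fin n) (H : SmoothFn U) : SmoothFn U :=
  ⟨pd i H, H.2.pd_of_isOpen hU i⟩

/-- The `k`-th derivative of `∂ᵢH` is the `(k+1)`-st derivative of `H` with its last argument fixed.
-/
theorem continuous_diff (hU : IsOpen U) (i : Fin n) : Continuous (diff hU i) := by
  refine continuous_of_jets hU fun k => ?_
  set L := ContinuousLinearMap.apply ℝ ℝ (Pi.single i 1 : Fin n → ℝ)
  have : (fun z : SmoothFn U × U => iteratedFDeriv ℝ k (diff hU i z.1) z.2) =
      fun z => L.compContinuousMultilinearMap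
        (continuousMultilinearCurryRightEquiv' ℝ k (Fin n → ℝ) ℝ
          (iteratedFDeriv ℝ (k + 1) z.1 z.2)) := by
    funext z
    rw [iteratedFDeriv_succ_eq_comp_right, Function.comp_apply, LinearIsometryEquiv.apply_symm_apply,
      ← L.iteratedFDeriv_comp_left (n := ∞) ?_ (by exact_mod_cast le_top)]
    · rfl
    · exact (z.1.contDiffAt hU z.2.2).fderiv_right (by simp)
  rw [this]
  exact (ContinuousLinearMap.compContinuousMultilinearMapL ℝ _ _ _ L).continuous.comp
    ((LinearIsometryEquiv.continuous _).comp (continuous_jet_eval hU (k + 1)))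

end SmoothFn

/-! ### Calculus of partial derivatives, and polynomials. -/

section PartialDerivatives

variable {n : ℕ} {U : Set (Fin n → ℝ)}

theorem fderiv_apply_eq_sum_pd (f : (Fin n → ℝ) → ℝ) (q w : Fin n → ℝ) :
    fderiv ℝ f q w = ∑ l, w l * pd l f q := by
  conv_lhs => rw [← Finset.univ_sum_single w]
  rw [map_sum]
  refine Finset.sum_congr rfl fun l _ => ?_
  have : (Pi.single l (w l) : Fin n → ℝ) = w l • Pi.single l 1 := by
    rw [← Pi.single_smul]; simp
  rw [this, map_smul, smul_eq_mul, pd]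

theorem pd_congr (hU : IsOpen U) {f g : (Fin n → ℝ) → ℝ} (h : ∀ q ∈ U, f q = g q) (i : Fin n) :
    ∀ q ∈ U, pd i f q = pd i g q := fun q hq => by
  have : f =ᶠ[𝓝 q] g := by
    filter_upwards [hU.mem_nhds hq] with x hx using h x hx
  rw [pd, pd, this.fderiv_eq]

theorem pd_add {f g : (Fin n → ℝ) → ℝ} {q : Fin n → ℝ} (hf : DifferentiableAt ℝ f q)
    (hg : DifferentiableAt ℝ g q) (i : Fin n) :
    pd i (fun x => f x + g x) q = pd i f q + pd i g q := by
  simp only [pd, fderiv_fun_add hf hg, _root_.add_apply]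

theorem pd_sub {f g : (Fin n → ℝ) → ℝ} {q : Fin n → ℝ} (hf : DifferentiableAt ℝ f q)
    (hg : DifferentiableAt ℝ g q) (i : Fin n) :
    pd i (fun x => f x - g x) q = pd i f q - pd i g q := by
  simp only [pd, fderiv_fun_sub hf hg, _root_.sub_apply]

theorem pd_mul {f g : (Fin n → ℝ) → ℝ} {q : Fin n → ℝ} (hf : DifferentiableAt ℝ f q)
    (hg : DifferentiableAt ℝ g q) (i : Fin n) :
    pd i (fun x => f x * g x) q = pd i f q * g q + f q * pd i g q := by
  simp only [pd, fderiv_fun_mul hf hg, _root_.add_apply,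
    _root_.smul_apply, smul_eq_mul]
  ring

theorem pd_comm (hU : IsOpen U) {f : (Fin n → ℝ) → ℝ} (hf : ContDiffOn ℝ ∞ f U) (i j : Fin n) :
    ∀ q ∈ U, pd i (pd j f) q = pd j (pd i f) q := by
  intro q hq
  have hc : ContDiffAt ℝ ∞ f q := hf.contDiffAt (hU.mem_nhds hq)
  have hd : DifferentiableAt ℝ (fderiv ℝ f) q :=
    (hc.fderiv_right (m := 1) (by norm_cast)).differentiableAt (by simp)
  have key : ∀ i j : Fin n, pd i (pd j f) q =
      fderiv ℝ (fderiv ℝ f) q (Pi.single i 1) (Pi.single j 1) := by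
    intro i j
    change fderiv ℝ (fun x => fderiv ℝ f x (Pi.single j 1)) q (Pi.single i 1) = _
    rw [fderiv_clm_apply hd (differentiableAt_const _)]
    simp
  rw [key, key]
  exact (hc.isSymmSndFDerivAt (by simp; exact WithTop.coe_le_coe.2 le_top)) _ _

theorem MvPolynomial.differentiable_eval (P : MvPolynomial (Fin n) ℝ) :
    Differentiable ℝ fun q => MvPolynomial.eval q P :=
  fun q => (AnalyticOnNhd.eval_mvPolynomial P q (mem_univ _)).differentiableAt

theorem MvPolynomial.contDiff_eval (P : MvPolynomial (Fin n) ℝ) :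
    ContDiff ℝ ∞ fun q => MvPolynomial.eval q P :=
  contDiff_iff_contDiffAt.2 fun q =>
    (AnalyticOnNhd.eval_mvPolynomial P q (mem_univ _)).contDiffAt

theorem pd_eval (P : MvPolynomial (Fin n) ℝ) (i : Fin n) (q : Fin n → ℝ) :
    pd i (fun x => MvPolynomial.eval x P) q = MvPolynomial.eval q (MvPolynomial.pderiv i P) := by
  classical
  induction P using MvPolynomial.induction_on with
  | C a => simp [pd]
  | add p r hp hr =>
    simp only [map_add]
    rw [pd_add (p.differentiable_eval q) (r.differentiable_eval q), hp, hr]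
  | mul_X p j hp =>
    simp only [map_mul, MvPolynomial.eval_X]
    have hX : pd i (fun x : Fin n → ℝ => x j) q = Pi.single (M := fun _ => ℝ) i 1 j := by
      rw [pd, (hasFDerivAt_apply j q).fderiv]
      rfl
    rw [pd_mul (p.differentiable_eval q) (differentiableAt_apply j q), hp, hX,
      MvPolynomial.pderiv_mul, MvPolynomial.pderiv_X]
    simp [Pi.single_apply, apply_ite (MvPolynomial.eval q)]

theorem pd_eq_add_eval (hU : IsOpen U) {f g : (Fin n → ℝ) → ℝ} (hf : ContDiffOn ℝ ∞ f U)
    {P : MvPolynomial (Fin n) ℝ} (h : ∀ q ∈ U, g q = f q + MvPolynomial.eval q P) (i : Fin n) :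
    ∀ q ∈ U, pd i g q = pd i f q + MvPolynomial.eval q (MvPolynomial.pderiv i P) := by
  intro q hq
  rw [pd_congr hU h i q hq, pd_add ?_ (P.differentiable_eval q), pd_eval]
  exact (hf.contDiffAt (hU.mem_nhds hq)).differentiableAt (by simp)

end PartialDerivatives

/-! ### Polynomial perturbations and a criterion for residuality. -/

namespace SmoothFn

variable {n m : ℕ} {U : Set (Fin n → ℝ)}

/-- The perturbation `H + ∑ aₖ pₖ` of `H` by a linear combination of polynomials. -/
noncomputable def perturb (H : SmoothFn U) (p : Fin m → MvPolynomial (Fin n) ℝ)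
    (a : Fin m → ℝ) : SmoothFn U :=
  ⟨fun q => H q + ∑ k, a k * MvPolynomial.eval q (p k),
    H.2.add (ContDiffOn.sum fun k _ => contDiffOn_const.mul (p k).contDiff_eval.contDiffOn)⟩

theorem perturb_zero (H : SmoothFn U) (p : Fin m → MvPolynomial (Fin n) ℝ) :
    H.perturb p 0 = H := by
  apply Subtype.ext
  funext q
  simp [perturb]

theorem perturb_apply (H : SmoothFn U) (p : Fin m → MvPolynomial (Fin n) ℝ) (a : Fin m → ℝ)
    (q : Fin n → ℝ) :
    H.perturb p a q = H q + MvPolynomial.eval q (∑ k, MvPolynomial.C (a k) * p k) := by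
  simp [perturb]

theorem continuous_perturb (hU : IsOpen U) (H : SmoothFn U)
    (p : Fin m → MvPolynomial (Fin n) ℝ) : Continuous (H.perturb p) := by
  refine continuous_of_jets hU fun k => ?_
  have : (fun z : (Fin m → ℝ) × U => iteratedFDeriv ℝ k (H.perturb p z.1) z.2) =
      fun z => iteratedFDeriv ℝ k H z.2 +
        ∑ l, z.1 l • iteratedFDeriv ℝ k (fun q => MvPolynomial.eval q (p l)) z.2 := by
    funext z
    have hp : ∀ l, ContDiff ℝ k fun q => MvPolynomial.eval q (p l) := fun l =>
      (p l).contDiff_eval.of_le (by exact_mod_cast le_top)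
    have hs : ∀ l, ContDiff ℝ k fun q => z.1 l • MvPolynomial.eval q (p l) := fun l =>
      contDiff_const.mul (hp l)
    change iteratedFDeriv ℝ k (H.1 + fun q => ∑ l, z.1 l • MvPolynomial.eval q (p l)) z.2 = _
    rw [iteratedFDeriv_add_apply, iteratedFDeriv_sum fun l _ => hs l]
    · congr 1
      rw [Finset.sum_apply]
      exact Finset.sum_congr rfl fun l _ => 
        iteratedFDeriv_const_smul_apply (a := z.1 l) (hp l).contDiffAt
    · exact (H.contDiffAt hU z.2.2).of_le (by exact_mod_cast le_top)
    · exact (ContDiff.sum fun l _ => hs l).contDiffAt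
  rw [this]
  refine ((jet hU k H).continuous.comp continuous_snd).add
    (continuous_finsetSum _ fun l _ => ?_)
  refine ((continuous_apply l).comp continuous_fst).smul ?_
  exact ((p l).contDiff_eval.continuous_iteratedFDeriv (by exact_mod_cast le_top)).comp
    (continuous_subtype_val.comp continuous_snd)

/-- A closed condition on pairs `(H, q)` that a dense set of members of each family of polynomial
perturbations avoid, where `N ≠ 0`, is avoided generically. -/
theorem mem_residual_of_perturb (hU : IsOpen U) {B : Set (SmoothFn U × U)} (hB : IsClosed B)
    {N : SmoothFn U × U → ℝ} (hN : Continuous N) (p : Fin m → MvPolynomial (Fin n) ℝ)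
    (hd : ∀ H : SmoothFn U,
      Dense {a : Fin m → ℝ | ∀ q : U, N (H.perturb p a, q) ≠ 0 → (H.perturb p a, q) ∉ B}) :
    {H : SmoothFn U | ∀ q : U, N (H, q) ≠ 0 → (H, q) ∉ B} ∈ residual (SmoothFn U) := by
  have : LocallyCompactSpace U := hU.locallyCompactSpace
  -- The open condition `N ≠ 0` is exhausted by the closed conditions `1/(r+1) ≤ |N|`, and `U` by
  -- compact sets. Each piece is then avoided on an open set of `H`, by compactness in `q`.
  set O : ℕ → ℕ → Set (SmoothFn U) := fun l r =>
    {H | ∀ q ∈ compactCovering U l, ¬ (1 / ((r : ℝ) + 1) ≤ |N (H, q)| ∧ (H, q) ∈ B)} with hO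
  have hopen : ∀ l r, IsOpen (O l r) := by
    intro l r
    rw [isOpen_iff_mem_nhds]
    intro H hH
    refine (isCompact_compactCovering U l).eventually_forall_of_forall_eventually
      (P := fun H q => ¬ (1 / ((r : ℝ) + 1) ≤ |N (H, q)| ∧ (H, q) ∈ B)) fun q hq => ?_
    have hc : IsClosed {z : SmoothFn U × U | 1 / ((r : ℝ) + 1) ≤ |N z| ∧ z ∈ B} :=
      (isClosed_le continuous_const hN.abs).inter hB
    exact hc.isOpen_compl.mem_nhds (hH q hq)
  have hdense : ∀ l r, Dense (O l r) := by
    intro l r H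
    rw [mem_closure_iff_nhds]
    intro V hV
    -- Perturbations with small coefficients stay in `V`, and good coefficients are dense near `0`.
    have h0 : H.perturb p ⁻¹' V ∈ 𝓝 0 :=
      (continuous_perturb hU H p).continuousAt.preimage_mem_nhds (by rwa [perturb_zero])
    obtain ⟨a, haV, ha⟩ := mem_closure_iff_nhds.1 (hd H 0) _ h0
    refine ⟨_, haV, fun q _ hq => ha q (fun h0 => ?_) hq.2⟩
    have := hq.1
    rw [h0, abs_zero] at this
    exact absurd this (not_le.2 (by positivity))
  have : (⋂ l, ⋂ r, O l r) ∈ residual (SmoothFn U) :=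
    countable_iInter_mem.2 fun l => countable_iInter_mem.2 fun r =>
      residual_of_dense_open (hopen l r) (hdense l r)
  filter_upwards [this] with H hH q hq hqB
  obtain ⟨l, hl⟩ := exists_mem_compactCovering q
  obtain ⟨r, hr⟩ := exists_nat_one_div_lt (abs_pos.2 hq)
  simp only [mem_iInter] at hH
  exact hH l r q hl ⟨hr.le, hqB⟩

end SmoothFn

/-! ### Two easy forms of Sard's theorem. -/

/-- A `C¹` map is locally Lipschitz and so does not raise Hausdorff dimension. -/
theorem dense_compl_image_of_lt {n m : ℕ} (hnm : n < m) {S : Set (Fin n → ℝ)} (hS : IsOpen S)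
    {Ψ : (Fin n → ℝ) → (Fin m → ℝ)} (hΨ : ContDiffOn ℝ 1 Ψ S) : Dense (Ψ '' S)ᶜ := by
  apply dense_compl_of_dimH_lt_finrank
  refine lt_of_le_of_lt (dimH_image_le_of_locally_lipschitzOn fun q hq => ?_) ?_
  · obtain ⟨C, t, ht, h⟩ := (hΨ.contDiffAt (hS.mem_nhds hq)).exists_lipschitzOnWith
    exact ⟨C, t, mem_nhdsWithin_of_mem_nhds ht, h⟩
  · refine lt_of_le_of_lt (dimH_mono (subset_univ S)) ?_
    rw [Real.dimH_univ_eq_finrank]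
    simpa using hnm

theorem dense_setOf_det_fderiv_ne_zero {n : ℕ} {S : Set (Fin n → ℝ)} (hS : IsOpen S)
    {Ψ : (Fin n → ℝ) → (Fin n → ℝ)} (hΨ : ContDiffOn ℝ 1 Ψ S) :
    Dense {a | ∀ q ∈ S, Ψ q = a → (fderiv ℝ Ψ q).det ≠ 0} := by
  have h := MeasureTheory.addHaar_image_eq_zero_of_det_fderivWithin_eq_zero
    (MeasureTheory.volume) (f := Ψ) (s := {q ∈ S | (fderiv ℝ Ψ q).det = 0}) (f' := fderiv ℝ Ψ)
    (fun q hq => ((hΨ.contDiffAt (hS.mem_nhds hq.1)).differentiableAt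
      (by simp)).hasFDerivAt.hasFDerivWithinAt) (fun q hq => hq.2)
  refine (MeasureTheory.Measure.dense_of_ae
    (MeasureTheory.measure_eq_zero_iff_ae_notMem.1 h)).mono fun a ha q hq hqa h0 => ?_
  exact ha ⟨q, ⟨hq, h0⟩, hqa⟩

/-! ### Elimination of the differential of `∂ⱼf`, and genericity by dimension count. -/

section ReducedJets

variable {n : ℕ}

/-- The determinant of the Hessian of `f` in the coordinates `i`, `j`. -/
noncomputable def hessDet (i j : Fin n) (f : (Fin n → ℝ) → ℝ) (q : Fin n → ℝ) : ℝ :=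
  pd i (pd i f) q * pd j (pd j f) q - pd i (pd j f) q ^ 2

/-- The `l`-th partial derivative of `hessDet i j f`. -/
noncomputable def hessDetDeriv (i j l : Fin n) (f : (Fin n → ℝ) → ℝ) (q : Fin n → ℝ) : ℝ :=
  pd l (pd i (pd i f)) q * pd j (pd j f) q + pd i (pd i f) q * pd l (pd j (pd j f)) q
    - 2 * pd i (pd j f) q * pd l (pd i (pd j f)) q

/-- The `l`-th partial derivative of `∂ᵢf`, reduced by means of the differential of `∂ⱼf`. -/
noncomputable def reducedGrad (i j l : Fin n) (f : (Fin n → ℝ) → ℝ) (q : Fin n → ℝ) : ℝ :=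
  pd j (pd j f) q * pd l (pd i f) q - pd i (pd j f) q * pd l (pd j f) q

/-- The `l`-th partial derivative of `hessDet i j f`, reduced by means of the differential
of `∂ⱼf`. -/
noncomputable def reducedDet (i j l : Fin n) (f : (Fin n → ℝ) → ℝ) (q : Fin n → ℝ) : ℝ :=
  pd j (pd j f) q * hessDetDeriv i j l f q - hessDetDeriv i j j f q * pd l (pd j f) q

end ReducedJets

namespace SmoothFn

variable {n m : ℕ} {U : Set (Fin n → ℝ)}

theorem contDiffOn_pd (hU : IsOpen U) (H : SmoothFn U) (i : Fin n) : ContDiffOn ℝ ∞ (pd i H) U :=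
  (diff hU i H).2

theorem contDiffOn_pd_pd (hU : IsOpen U) (H : SmoothFn U) (i j : Fin n) :
    ContDiffOn ℝ ∞ (pd i (pd j H)) U :=
  (diff hU i (diff hU j H)).2

theorem contDiffOn_pd_pd_pd (hU : IsOpen U) (H : SmoothFn U) (i j k : Fin n) :
    ContDiffOn ℝ ∞ (pd i (pd j (pd k H))) U :=
  (diff hU i (diff hU j (diff hU k H))).2

theorem continuous_pd (hU : IsOpen U) (i : Fin n) :
    Continuous fun z : SmoothFn U × U => pd i z.1 z.2 :=
  (continuous_eval hU).comp (((continuous_diff hU i).comp continuous_fst).prodMk continuous_snd)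

theorem continuous_pd_pd (hU : IsOpen U) (i j : Fin n) :
    Continuous fun z : SmoothFn U × U => pd i (pd j z.1) z.2 :=
  (continuous_pd hU i).comp (((continuous_diff hU j).comp continuous_fst).prodMk continuous_snd)

theorem continuous_pd_pd_pd (hU : IsOpen U) (i j k : Fin n) :
    Continuous fun z : SmoothFn U × U => pd i (pd j (pd k z.1)) z.2 :=
  (continuous_pd_pd hU i j).comp
    (((continuous_diff hU k).comp continuous_fst).prodMk continuous_snd)

theorem continuous_hessDet (hU : IsOpen U) (i j : Fin n) :
    Continuous fun z : SmoothFn U × U => hessDet i j z.1 z.2 :=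
  ((continuous_pd_pd hU i i).mul (continuous_pd_pd hU j j)).sub ((continuous_pd_pd hU i j).pow 2)

theorem continuous_hessDetDeriv (hU : IsOpen U) (i j l : Fin n) :
    Continuous fun z : SmoothFn U × U => hessDetDeriv i j l z.1 z.2 :=
  (((continuous_pd_pd_pd hU l i i).mul (continuous_pd_pd hU j j)).add
    ((continuous_pd_pd hU i i).mul (continuous_pd_pd_pd hU l j j))).sub
    ((continuous_const.mul (continuous_pd_pd hU i j)).mul (continuous_pd_pd_pd hU l i j))

theorem continuous_reducedGrad (hU : IsOpen U) (i j l : Fin n) :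
    Continuous fun z : SmoothFn U × U => reducedGrad i j l z.1 z.2 :=
  ((continuous_pd_pd hU j j).mul (continuous_pd_pd hU l i)).sub
    ((continuous_pd_pd hU i j).mul (continuous_pd_pd hU l j))

theorem continuous_reducedDet (hU : IsOpen U) (i j l : Fin n) :
    Continuous fun z : SmoothFn U × U => reducedDet i j l z.1 z.2 :=
  ((continuous_pd_pd hU j j).mul (continuous_hessDetDeriv hU i j l)).sub
    ((continuous_hessDetDeriv hU i j j).mul (continuous_pd_pd hU l j))

theorem contDiffOn_hessDet (hU : IsOpen U) (H : SmoothFn U) (i j : Fin n) :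
    ContDiffOn ℝ ∞ (hessDet i j H) U :=
  ((H.contDiffOn_pd_pd hU i i).mul (H.contDiffOn_pd_pd hU j j)).sub
    ((H.contDiffOn_pd_pd hU i j).pow 2)

theorem contDiffOn_hessDetDeriv (hU : IsOpen U) (H : SmoothFn U) (i j l : Fin n) :
    ContDiffOn ℝ ∞ (hessDetDeriv i j l H) U :=
  (((H.contDiffOn_pd_pd_pd hU l i i).mul (H.contDiffOn_pd_pd hU j j)).add
    ((H.contDiffOn_pd_pd hU i i).mul (H.contDiffOn_pd_pd_pd hU l j j))).sub
    ((contDiffOn_const.mul (H.contDiffOn_pd_pd hU i j)).mul (H.contDiffOn_pd_pd_pd hU l i j))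

theorem contDiffOn_reducedGrad (hU : IsOpen U) (H : SmoothFn U) (i j l : Fin n) :
    ContDiffOn ℝ ∞ (reducedGrad i j l H) U :=
  ((H.contDiffOn_pd_pd hU j j).mul (H.contDiffOn_pd_pd hU l i)).sub
    ((H.contDiffOn_pd_pd hU i j).mul (H.contDiffOn_pd_pd hU l j))

theorem pd_hessDet (hU : IsOpen U) (H : SmoothFn U) (i j l : Fin n) {q : Fin n → ℝ} (hq : q ∈ U) :
    pd l (hessDet i j H) q = hessDetDeriv i j l H q := by
  have hd : ∀ i j, DifferentiableAt ℝ (pd i (pd j H)) q := fun i j =>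
    ((H.contDiffOn_pd_pd hU i j).contDiffAt (hU.mem_nhds hq)).differentiableAt (by simp)
  have hs : hessDet i j H = fun q => pd i (pd i H) q * pd j (pd j H) q
      - pd i (pd j H) q * pd i (pd j H) q := by
    funext q; rw [hessDet, sq]
  rw [hs, pd_sub ((hd _ _).fun_mul (hd _ _)) ((hd _ _).fun_mul (hd _ _)), pd_mul (hd _ _) (hd _ _),
    pd_mul (hd _ _) (hd _ _), hessDetDeriv]
  ring

theorem pd_perturb (hU : IsOpen U) (H : SmoothFn U) (p : Fin m → MvPolynomial (Fin n) ℝ)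
    (a : Fin m → ℝ) (i : Fin n) {q : Fin n → ℝ} (hq : q ∈ U) :
    pd i (H.perturb p a) q = pd i H q +
      MvPolynomial.eval q (MvPolynomial.pderiv i (∑ k, MvPolynomial.C (a k) * p k)) :=
  pd_eq_add_eval hU H.2 (fun q _ => H.perturb_apply p a q) i q hq

theorem pd_pd_perturb (hU : IsOpen U) (H : SmoothFn U) (p : Fin m → MvPolynomial (Fin n) ℝ)
    (a : Fin m → ℝ) (i j : Fin n) {q : Fin n → ℝ} (hq : q ∈ U) :
    pd i (pd j (H.perturb p a)) q = pd i (pd j H) q + MvPolynomial.eval q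
      (MvPolynomial.pderiv i (MvPolynomial.pderiv j (∑ k, MvPolynomial.C (a k) * p k))) :=
  pd_eq_add_eval hU (H.contDiffOn_pd hU j) (fun _ hq => H.pd_perturb hU p a j hq) i q hq

theorem pd_pd_pd_perturb (hU : IsOpen U) (H : SmoothFn U) (p : Fin m → MvPolynomial (Fin n) ℝ)
    (a : Fin m → ℝ) (i j k : Fin n) {q : Fin n → ℝ} (hq : q ∈ U) :
    pd i (pd j (pd k (H.perturb p a))) q = pd i (pd j (pd k H)) q +
      MvPolynomial.eval q (MvPolynomial.pderiv i (MvPolynomial.pderiv j (MvPolynomial.pderiv k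
        (∑ k, MvPolynomial.C (a k) * p k)))) :=
  pd_eq_add_eval hU (H.contDiffOn_pd_pd hU j k) (fun _ hq => H.pd_pd_perturb hU p a j k hq) i q hq

/-- A closed condition that forces the coefficients of a perturbation to be a `C¹` function of
fewer variables is avoided generically. -/
theorem mem_residual_of_image (hU : IsOpen U) {B : Set (SmoothFn U × U)} (hB : IsClosed B)
    {N : SmoothFn U × U → ℝ} (hN : Continuous N) (hnm : n < m)
    (p : Fin m → MvPolynomial (Fin n) ℝ)
    (hΨ : ∀ H : SmoothFn U, ∃ (Ψ : (Fin n → ℝ) → Fin m → ℝ) (S : Set (Fin n → ℝ)), IsOpen S ∧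
      ContDiffOn ℝ ∞ Ψ S ∧ ∀ (a : Fin m → ℝ) (q : U), N (H.perturb p a, q) ≠ 0 →
        (H.perturb p a, q) ∈ B → (q : Fin n → ℝ) ∈ S ∧ Ψ q = a) :
    {H : SmoothFn U | ∀ q : U, N (H, q) ≠ 0 → (H, q) ∉ B} ∈ residual (SmoothFn U) := by
  refine mem_residual_of_perturb hU hB hN p fun H => ?_
  obtain ⟨Ψ, S, hS, hc, h⟩ := hΨ H
  refine (dense_compl_image_of_lt hnm hS (hc.of_le (by simp))).mono fun a ha q hq hqB => ?_
  obtain ⟨h1, h2⟩ := h a q hq hqB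
  exact ha ⟨q, h1, h2⟩

/-- Generically, the gradient and the Hessian in two variables do not vanish together. -/
theorem residual_hess_ne_zero (hU : IsOpen U) (hn : n < 5) {i j : Fin n} (hij : i ≠ j) :
    {H : SmoothFn U | ∀ q : U, ¬ (pd i H q = 0 ∧ pd j H q = 0 ∧ pd i (pd i H) q = 0 ∧
      pd i (pd j H) q = 0 ∧ pd j (pd j H) q = 0)} ∈ residual (SmoothFn U) := by
  have hB : IsClosed {z : SmoothFn U × U | pd i z.1 z.2 = 0 ∧ pd j z.1 z.2 = 0 ∧
      pd i (pd i z.1) z.2 = 0 ∧ pd i (pd j z.1) z.2 = 0 ∧ pd j (pd j z.1) z.2 = 0} :=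
    (isClosed_eq (continuous_pd hU i) continuous_const).inter <|
    (isClosed_eq (continuous_pd hU j) continuous_const).inter <|
    (isClosed_eq (continuous_pd_pd hU i i) continuous_const).inter <|
    (isClosed_eq (continuous_pd_pd hU i j) continuous_const).inter
    (isClosed_eq (continuous_pd_pd hU j j) continuous_const)
  refine mem_of_superset (mem_residual_of_image hU hB (N := fun _ => 1) continuous_const hn
    ![.X i, .X j, (.X i * .X i), .X i * .X j, .X j * .X j] fun H => ?_)
    fun H hH q => hH q one_ne_zero
  -- The second-order equations fix the three quadratic coefficients; the gradient equations then
  -- fix the linear ones.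
  refine ⟨fun q => ![-(pd i H q - pd i (pd i H) q * q i - pd i (pd j H) q * q j),
    -(pd j H q - pd i (pd j H) q * q i - pd j (pd j H) q * q j),
    -pd i (pd i H) q / 2, -pd i (pd j H) q, -pd j (pd j H) q / 2], U, hU, ?_, ?_⟩
  · have h1 := H.contDiffOn_pd hU
    have h2 := H.contDiffOn_pd_pd hU
    rw [contDiffOn_pi]
    intro k
    fin_cases k <;> simp <;> fun_prop
  · rintro a ⟨q, hq⟩ - ⟨e1, e2, e3, e4, e5⟩
    refine ⟨hq, ?_⟩
    simp only [H.pd_perturb hU _ a _ hq, H.pd_pd_perturb hU _ a _ _ hq] at e1 e2 e3 e4 e5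
    simp [Fin.sum_univ_five, MvPolynomial.pderiv_X_of_ne hij, MvPolynomial.pderiv_X_of_ne hij.symm] at e1 e2 e3 e4 e5
    funext k
    fin_cases k <;> simp
    · linear_combination -e1 + e3 * q i + e4 * q j
    · linear_combination -e2 + e4 * q i + e5 * q j
    · linear_combination -e3 / 2
    · linear_combination -e4
    · linear_combination -e5 / 2

/-- Generically, `∂_D H` is a regular equation. -/
theorem residual_regular_pd_two {U : Set (Fin 4 → ℝ)} (hU : IsOpen U) :
    {H : SmoothFn U | ∀ q : U, ¬ (pd 2 H q = 0 ∧ ∀ l, pd l (pd 2 H) q = 0)} ∈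
      residual (SmoothFn U) := by
  have hB : IsClosed {z : SmoothFn U × U | pd 2 z.1 z.2 = 0 ∧ ∀ l, pd l (pd 2 z.1) z.2 = 0} := by
    rw [show {z : SmoothFn U × U | pd 2 z.1 z.2 = 0 ∧ ∀ l, pd l (pd 2 z.1) z.2 = 0} =
      {z | pd 2 z.1 z.2 = 0} ∩ ⋂ l, {z | pd l (pd 2 z.1) z.2 = 0} by ext; simp]
    refine (isClosed_eq (continuous_pd hU 2) continuous_const).inter ?_
    exact isClosed_iInter fun l => isClosed_eq (continuous_pd_pd hU l 2) continuous_const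
  refine mem_of_superset (mem_residual_of_image hU hB (N := fun _ => 1) continuous_const
    (by norm_num : 4 < 5) ![.X 2, .X 0 * .X 2, .X 1 * .X 2, .X 2 * .X 2, .X 3 * .X 2] fun H => ?_)
    fun H hH q => hH q one_ne_zero
  refine ⟨fun q => ![-(pd 2 H q - pd 0 (pd 2 H) q * q 0 - pd 1 (pd 2 H) q * q 1
      - pd 2 (pd 2 H) q * q 2 - pd 3 (pd 2 H) q * q 3),
    -pd 0 (pd 2 H) q, -pd 1 (pd 2 H) q, -pd 2 (pd 2 H) q / 2, -pd 3 (pd 2 H) q], U, hU, ?_, ?_⟩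
  · have h1 := H.contDiffOn_pd hU
    have h2 := H.contDiffOn_pd_pd hU
    rw [contDiffOn_pi]
    intro k
    fin_cases k <;> simp <;> fun_prop
  · rintro a ⟨q, hq⟩ - ⟨e, e'⟩
    refine ⟨hq, ?_⟩
    have e0 := e' 0
    have e1 := e' 1
    have e2 := e' 2
    have e3 := e' 3
    simp only [H.pd_perturb hU _ a _ hq, H.pd_pd_perturb hU _ a _ _ hq] at e e0 e1 e2 e3
    simp [Fin.sum_univ_five, MvPolynomial.pderiv_X] at e e0 e1 e2 e3
    funext k
    fin_cases k <;> simp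
    · linear_combination -e + e0 * q 0 + e1 * q 1 + e2 * q 2 + e3 * q 3
    · linear_combination -e0
    · linear_combination -e1
    · linear_combination -e2 / 2
    · linear_combination -e3

end SmoothFn

/-! ### Generic independence of the equations of parabolic points. -/

namespace SmoothFn

variable {n m : ℕ} {U : Set (Fin n → ℝ)}

theorem isOpen_pd_pd_ne_zero (hU : IsOpen U) (H : SmoothFn U) (j : Fin n) :
    IsOpen (U ∩ {q | pd j (pd j H) q ≠ 0}) :=
  (H.contDiffOn_pd_pd hU j j).continuousOn.isOpen_inter_preimage hU isOpen_ne

/-- Generically, the reduced gradient does not vanish at parabolic points. -/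
theorem residual_reducedGrad (hU : IsOpen U) (hn : n < 5) {i j d c : Fin n} (hij : i ≠ j)
    (hid : i ≠ d) (hjd : j ≠ d) (hic : i ≠ c) (hjc : j ≠ c) (hdc : d ≠ c) :
    {H : SmoothFn U | ∀ q : U, pd j (pd j H) q ≠ 0 → ¬ (pd i H q = 0 ∧ pd j H q = 0 ∧
      hessDet i j H q = 0 ∧ reducedGrad i j d H q = 0 ∧ reducedGrad i j c H q = 0)} ∈
      residual (SmoothFn U) := by
  have hB : IsClosed {z : SmoothFn U × U | pd i z.1 z.2 = 0 ∧ pd j z.1 z.2 = 0 ∧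
      hessDet i j z.1 z.2 = 0 ∧ reducedGrad i j d z.1 z.2 = 0 ∧
      reducedGrad i j c z.1 z.2 = 0} :=
    (isClosed_eq (continuous_pd hU i) continuous_const).inter <|
    (isClosed_eq (continuous_pd hU j) continuous_const).inter <|
    (isClosed_eq (continuous_hessDet hU i j) continuous_const).inter <|
    (isClosed_eq (continuous_reducedGrad hU i j d) continuous_const).inter
    (isClosed_eq (continuous_reducedGrad hU i j c) continuous_const)
  refine mem_residual_of_image hU hB (continuous_pd_pd hU j j) hn
    ![.X i, .X j, .X i * .X i, .X i * .X d, .X i * .X c] fun H => ?_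
  set S := U ∩ {q | pd j (pd j H) q ≠ 0}
  have hne : ∀ q ∈ S, pd j (pd j H) q ≠ 0 := fun q hq => hq.2
  have hSU : S ⊆ U := inter_subset_left
  -- Every perturbing monomial except `xⱼ` contains `xᵢ`, so the perturbation leaves `∂ⱼ²`, `∂ᵢ∂ⱼ`,
  -- `∂_d∂ⱼ` and `∂_c∂ⱼ` unchanged. It adds `2a₂∂ⱼ²H` to the determinant and `a₃∂ⱼ²H`, `a₄∂ⱼ²H` to
  -- the two reduced gradients.
  set a2 : (Fin n → ℝ) → ℝ := fun q => -hessDet i j H q / (2 * pd j (pd j H) q)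
  set a3 : (Fin n → ℝ) → ℝ := fun q => -reducedGrad i j d H q / pd j (pd j H) q
  set a4 : (Fin n → ℝ) → ℝ := fun q => -reducedGrad i j c H q / pd j (pd j H) q
  have h1 := fun i => (H.contDiffOn_pd hU i).mono hSU
  have hjj := (H.contDiffOn_pd_pd hU j j).mono hSU
  have h2 : ContDiffOn ℝ ∞ a2 S := ((H.contDiffOn_hessDet hU i j).mono hSU).neg.div
    (contDiffOn_const.mul hjj) fun q hq => mul_ne_zero two_ne_zero (hne q hq)
  have h3 : ContDiffOn ℝ ∞ a3 S := ((H.contDiffOn_reducedGrad hU i j d).mono hSU).neg.div hjj hne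
  have h4 : ContDiffOn ℝ ∞ a4 S := ((H.contDiffOn_reducedGrad hU i j c).mono hSU).neg.div hjj hne
  refine ⟨fun q => ![-(pd i H q + 2 * a2 q * q i + a3 q * q d + a4 q * q c), -pd j H q,
    a2 q, a3 q, a4 q], S, H.isOpen_pd_pd_ne_zero hU j, ?_, ?_⟩
  · rw [contDiffOn_pi]
    intro k
    fin_cases k <;> simp <;> fun_prop
  · rintro a ⟨q, hq⟩ hN ⟨e1, e2, e3, e4, e5⟩
    simp only [hessDet, reducedGrad, H.pd_perturb hU _ a _ hq, H.pd_pd_perturb hU _ a _ _ hq]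
      at hN e1 e2 e3 e4 e5
    simp [Fin.sum_univ_five, MvPolynomial.pderiv_X_of_ne hij, MvPolynomial.pderiv_X_of_ne hij.symm,
      MvPolynomial.pderiv_X_of_ne hid, MvPolynomial.pderiv_X_of_ne hid.symm, MvPolynomial.pderiv_X_of_ne hjd.symm,
      MvPolynomial.pderiv_X_of_ne hic, MvPolynomial.pderiv_X_of_ne hic.symm, MvPolynomial.pderiv_X_of_ne hjc.symm,
      MvPolynomial.pderiv_X_of_ne hdc, MvPolynomial.pderiv_X_of_ne hdc.symm] at hN e1 e2 e3 e4 e5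
    have f2 : a2 q = a 2 := by
      simp only [a2, hessDet]
      field_simp
      linear_combination -e3
    have f3 : a3 q = a 3 := by
      simp only [a3, reducedGrad]
      field_simp
      linear_combination -e4
    have f4 : a4 q = a 4 := by
      simp only [a4, reducedGrad]
      field_simp
      linear_combination -e5
    refine ⟨⟨hq, hN⟩, ?_⟩
    funext k
    fin_cases k <;> simp [f2, f3, f4]
    · linear_combination -e1
    · linear_combination -e2

/-- Generically, the reduced differential of the Hessian determinant does not vanish in two
directions at parabolic points. -/
theorem residual_reducedDet (hU : IsOpen U) (hn : n < 5) {i j d : Fin n} (hij : i ≠ j)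
    (hid : i ≠ d) (hjd : j ≠ d) :
    {H : SmoothFn U | ∀ q : U, pd j (pd j H) q ≠ 0 → ¬ (pd i H q = 0 ∧ pd j H q = 0 ∧
      hessDet i j H q = 0 ∧ reducedDet i j i H q = 0 ∧ reducedDet i j d H q = 0)} ∈
      residual (SmoothFn U) := by
  have hB : IsClosed {z : SmoothFn U × U | pd i z.1 z.2 = 0 ∧ pd j z.1 z.2 = 0 ∧
      hessDet i j z.1 z.2 = 0 ∧ reducedDet i j i z.1 z.2 = 0 ∧
      reducedDet i j d z.1 z.2 = 0} :=
    (isClosed_eq (continuous_pd hU i) continuous_const).inter <|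
    (isClosed_eq (continuous_pd hU j) continuous_const).inter <|
    (isClosed_eq (continuous_hessDet hU i j) continuous_const).inter <|
    (isClosed_eq (continuous_reducedDet hU i j i) continuous_const).inter
    (isClosed_eq (continuous_reducedDet hU i j d) continuous_const)
  refine mem_residual_of_image hU hB (continuous_pd_pd hU j j) hn
    ![.X i, .X j, .X i * .X i, .X i * .X i * .X i, .X i * .X i * .X d] fun H => ?_
  set S := U ∩ {q | pd j (pd j H) q ≠ 0}
  have hne : ∀ q ∈ S, pd j (pd j H) q ≠ 0 := fun q hq => hq.2
  have hSU : S ⊆ U := inter_subset_left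
  -- `L` is the increment of `∂ᵢ²H` forced by the vanishing of the perturbed determinant. With it
  -- inserted, the perturbed reduced derivatives are `R i + 6a₃(∂ⱼ²H)²` and `R d + 2a₄(∂ⱼ²H)²`,
  -- which gives `a3` and `a4`.
  set L : (Fin n → ℝ) → ℝ := fun q => -hessDet i j H q / pd j (pd j H) q
  set R : Fin n → (Fin n → ℝ) → ℝ := fun l q =>
    pd j (pd j H) q * (hessDetDeriv i j l H q + L q * pd l (pd j (pd j H)) q) -
    (hessDetDeriv i j j H q + L q * pd j (pd j (pd j H)) q) * pd l (pd j H) q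
  set a3 : (Fin n → ℝ) → ℝ := fun q => -R i q / (6 * pd j (pd j H) q ^ 2)
  set a4 : (Fin n → ℝ) → ℝ := fun q => -R d q / (2 * pd j (pd j H) q ^ 2)
  set a2 : (Fin n → ℝ) → ℝ := fun q => (L q - 6 * a3 q * q i - 2 * a4 q * q d) / 2
  have h1 := fun i => (H.contDiffOn_pd hU i).mono hSU
  have hdd := fun i j => (H.contDiffOn_pd_pd hU i j).mono hSU
  have hddd := fun i j k => (H.contDiffOn_pd_pd_pd hU i j k).mono hSU
  have hD := fun l => (H.contDiffOn_hessDetDeriv hU i j l).mono hSU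
  have hL : ContDiffOn ℝ ∞ L S :=
    ((H.contDiffOn_hessDet hU i j).mono hSU).neg.div (hdd j j) hne
  have hR : ∀ l, ContDiffOn ℝ ∞ (R l) S := fun l => by
    simp only [R]
    fun_prop
  have h3 : ContDiffOn ℝ ∞ a3 S := (hR i).neg.div (contDiffOn_const.mul ((hdd j j).pow 2))
    fun q hq => mul_ne_zero (by norm_num) (pow_ne_zero 2 (hne q hq))
  have h4 : ContDiffOn ℝ ∞ a4 S := (hR d).neg.div (contDiffOn_const.mul ((hdd j j).pow 2))
    fun q hq => mul_ne_zero (by norm_num) (pow_ne_zero 2 (hne q hq))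
  have h2 : ContDiffOn ℝ ∞ a2 S := by
    simp only [a2]
    fun_prop
  refine ⟨fun q => ![-(pd i H q + 2 * a2 q * q i + 3 * a3 q * q i ^ 2 + 2 * a4 q * q i * q d),
    -(pd j H q), a2 q, a3 q, a4 q], S, H.isOpen_pd_pd_ne_zero hU j, ?_, ?_⟩
  · rw [contDiffOn_pi]
    intro k
    fin_cases k <;> simp <;> fun_prop
  · rintro a ⟨q, hq⟩ hN ⟨e1, e2, e3, e4, e5⟩
    simp only [hessDet, reducedDet, hessDetDeriv, H.pd_perturb hU _ a _ hq,
      H.pd_pd_perturb hU _ a _ _ hq, H.pd_pd_pd_perturb hU _ a _ _ _ hq] at hN e1 e2 e3 e4 e5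
    simp [Fin.sum_univ_five, MvPolynomial.pderiv_X_of_ne hij, MvPolynomial.pderiv_X_of_ne hij.symm,
      MvPolynomial.pderiv_X_of_ne hid, MvPolynomial.pderiv_X_of_ne hid.symm,
      MvPolynomial.pderiv_X_of_ne hjd.symm] at hN e1 e2 e3 e4 e5
    have fL : L q = 2 * a 2 + 6 * a 3 * q i + 2 * a 4 * q d := by
      simp only [L, hessDet]
      field_simp
      linear_combination -e3
    have f3 : a3 q = a 3 := by
      simp only [a3, R, fL, hessDetDeriv]
      field_simp
      linear_combination -e4
    have f4 : a4 q = a 4 := by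
      simp only [a4, R, fL, hessDetDeriv]
      field_simp
      linear_combination -e5
    have f2 : a2 q = a 2 := by
      simp only [a2, fL, f3, f4]
      ring
    refine ⟨⟨hq, hN⟩, ?_⟩
    funext k
    fin_cases k <;> simp [f2, f3, f4]
    · linear_combination -e1
    · linear_combination -e2

/-- Generically, the reduced differentials of the equations of parabolic points are not
proportional where the second one is nonzero. -/
theorem residual_reduced_proportional (hU : IsOpen U) (hn : n < 5) {i j d c : Fin n} (hij : i ≠ j)
    (hid : i ≠ d) (hic : i ≠ c) (hjc : j ≠ c) (hdc : d ≠ c) :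
    {H : SmoothFn U | ∀ q : U, pd j (pd j H) q * reducedDet i j d H q ≠ 0 →
      ¬ (pd i H q = 0 ∧ pd j H q = 0 ∧ hessDet i j H q = 0 ∧ reducedDet i j i H q = 0 ∧
        reducedGrad i j d H q * reducedDet i j c H q =
          reducedGrad i j c H q * reducedDet i j d H q)} ∈ residual (SmoothFn U) := by
  have hB : IsClosed {z : SmoothFn U × U | pd i z.1 z.2 = 0 ∧ pd j z.1 z.2 = 0 ∧
      hessDet i j z.1 z.2 = 0 ∧ reducedDet i j i z.1 z.2 = 0 ∧
      reducedGrad i j d z.1 z.2 * reducedDet i j c z.1 z.2 =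
        reducedGrad i j c z.1 z.2 * reducedDet i j d z.1 z.2} :=
    (isClosed_eq (continuous_pd hU i) continuous_const).inter <|
    (isClosed_eq (continuous_pd hU j) continuous_const).inter <|
    (isClosed_eq (continuous_hessDet hU i j) continuous_const).inter <|
    (isClosed_eq (continuous_reducedDet hU i j i) continuous_const).inter
    (isClosed_eq ((continuous_reducedGrad hU i j d).mul (continuous_reducedDet hU i j c))
      ((continuous_reducedGrad hU i j c).mul (continuous_reducedDet hU i j d)))
  refine mem_residual_of_image hU hB
    ((continuous_pd_pd hU j j).mul (continuous_reducedDet hU i j d)) hn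
    ![.X i, .X j, .X i * .X i, .X i * .X i * .X i, .X i * .X c] fun H => ?_
  set S₀ := U ∩ {q | pd j (pd j H) q ≠ 0}
  have hS₀U : S₀ ⊆ U := inter_subset_left
  set L : (Fin n → ℝ) → ℝ := fun q => -hessDet i j H q / pd j (pd j H) q
  set R : Fin n → (Fin n → ℝ) → ℝ := fun l q =>
    pd j (pd j H) q * (hessDetDeriv i j l H q + L q * pd l (pd j (pd j H)) q) -
    (hessDetDeriv i j j H q + L q * pd j (pd j (pd j H)) q) * pd l (pd j H) q
  have hR₀ : ∀ l, ContDiffOn ℝ ∞ (R l) S₀ := fun l => by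
    have hdd := fun i j => (H.contDiffOn_pd_pd hU i j).mono hS₀U
    have hddd := fun i j k => (H.contDiffOn_pd_pd_pd hU i j k).mono hS₀U
    have hD := fun l => (H.contDiffOn_hessDetDeriv hU i j l).mono hS₀U
    have hL : ContDiffOn ℝ ∞ L S₀ :=
      ((H.contDiffOn_hessDet hU i j).mono hS₀U).neg.div (hdd j j) fun q hq => hq.2
    simp only [R]
    fun_prop
  -- No perturbing monomial contributes to `∂_d∂ᵢ²`, so at a bad point `R d` equals the perturbed
  -- `reducedDet i j d`, which is nonzero there.
  set S := S₀ ∩ {q | R d q ≠ 0}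
  have hS : IsOpen S := (hR₀ d).continuousOn.isOpen_inter_preimage
    (H.isOpen_pd_pd_ne_zero hU j) isOpen_ne
  have hne : ∀ q ∈ S, pd j (pd j H) q ≠ 0 := fun q hq => hq.1.2
  have hSS₀ : S ⊆ S₀ := inter_subset_left
  have hSU : S ⊆ U := hSS₀.trans hS₀U
  have hR := fun l => (hR₀ l).mono hSS₀
  set a3 : (Fin n → ℝ) → ℝ := fun q => -R i q / (6 * pd j (pd j H) q ^ 2)
  -- The monomial `xᵢx_c` moves only the reduced gradient in direction `c`, by `a₄∂ⱼ²H`;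
  -- proportionality is then linear in `a₄` with coefficient `∂ⱼ²H · R d`, up to sign.
  set a4 : (Fin n → ℝ) → ℝ := fun q =>
    (reducedGrad i j d H q * R c q / R d q - reducedGrad i j c H q) / pd j (pd j H) q
  set a2 : (Fin n → ℝ) → ℝ := fun q => (L q - 6 * a3 q * q i) / 2
  have h1 := fun i => (H.contDiffOn_pd hU i).mono hSU
  have hdd := fun i j => (H.contDiffOn_pd_pd hU i j).mono hSU
  have hG := fun l => (H.contDiffOn_reducedGrad hU i j l).mono hSU
  have hL : ContDiffOn ℝ ∞ L S :=
    ((H.contDiffOn_hessDet hU i j).mono hSU).neg.div (hdd j j) hne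
  have h3 : ContDiffOn ℝ ∞ a3 S := (hR i).neg.div (contDiffOn_const.mul ((hdd j j).pow 2))
    fun q hq => mul_ne_zero (by norm_num) (pow_ne_zero 2 (hne q hq))
  have h4 : ContDiffOn ℝ ∞ a4 S :=
    ((((hG d).mul (hR c)).div (hR d) fun q hq => hq.2).sub (hG c)).div (hdd j j) hne
  have h2 : ContDiffOn ℝ ∞ a2 S := by
    simp only [a2]
    fun_prop
  refine ⟨fun q => ![-(pd i H q + 2 * a2 q * q i + 3 * a3 q * q i ^ 2 + a4 q * q c),
    -(pd j H q), a2 q, a3 q, a4 q], S, hS, ?_, ?_⟩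
  · rw [contDiffOn_pi]
    intro k
    fin_cases k <;> simp <;> fun_prop
  · rintro a ⟨q, hq⟩ hN ⟨e1, e2, e3, e4, e5⟩
    have hN1 := left_ne_zero_of_mul hN
    have hN2 := right_ne_zero_of_mul hN
    simp only [hessDet, reducedDet, reducedGrad, hessDetDeriv, H.pd_perturb hU _ a _ hq,
      H.pd_pd_perturb hU _ a _ _ hq, H.pd_pd_pd_perturb hU _ a _ _ _ hq]
      at hN1 hN2 e1 e2 e3 e4 e5
    simp [Fin.sum_univ_five, MvPolynomial.pderiv_X_of_ne hij, MvPolynomial.pderiv_X_of_ne hij.symm,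
      MvPolynomial.pderiv_X_of_ne hid,
      MvPolynomial.pderiv_X_of_ne hic, MvPolynomial.pderiv_X_of_ne hic.symm, MvPolynomial.pderiv_X_of_ne hjc.symm,
      MvPolynomial.pderiv_X_of_ne hdc.symm]
      at hN1 hN2 e1 e2 e3 e4 e5
    have fL : L q = 2 * a 2 + 6 * a 3 * q i := by
      simp only [L, hessDet]
      field_simp
      linear_combination -e3
    have fRd : R d q ≠ 0 := by
      convert hN2 using 1
      simp only [R, fL, hessDetDeriv]
      ring
    have f3 : a3 q = a 3 := by
      simp only [a3, R, fL, hessDetDeriv]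
      field_simp
      linear_combination -e4
    have f4 : a4 q = a 4 := by
      simp only [a4]
      rw [div_eq_iff hN1, sub_eq_iff_eq_add, div_eq_iff fRd]
      simp only [R, fL, hessDetDeriv, reducedGrad]
      linear_combination e5
    have f2 : a2 q = a 2 := by
      simp only [a2, fL, f3]
      ring
    refine ⟨⟨⟨hq, hN1⟩, fRd⟩, ?_⟩
    funext k
    fin_cases k <;> simp [f2, f3, f4]
    · linear_combination -e1
    · linear_combination -e2

end SmoothFn

/-! ### The four equations of parabolic points with `∂_d = 0`. -/

section FoldMatrix

variable {n : ℕ}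

/-- The differential of the equations `∂ᵢf = 0`, `∂ⱼf = 0`, `hessDet i j f = 0`, `∂_d f = 0`. -/
noncomputable def restMatrix (i j d : Fin n) (f : (Fin n → ℝ) → ℝ) (q : Fin n → ℝ) :
    Matrix (Fin 4) (Fin n) ℝ :=
  Matrix.of ![fun l => pd l (pd i f) q, fun l => pd l (pd j f) q, fun l => hessDetDeriv i j l f q,
    fun l => pd l (pd d f) q]

/-- The coefficients `a` of the perturbation `a₀xᵢ + a₁xⱼ + a₂xᵢ² + a₃x_d` that make `q` a
parabolic point with `∂_d = 0`. -/
noncomputable def restParam (i j d : Fin n) (f : (Fin n → ℝ) → ℝ) (q : Fin n → ℝ) : Fin 4 → ℝ :=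
  ![-(pd i f q + 2 * (-hessDet i j f q / (2 * pd j (pd j f) q)) * q i), -pd j f q,
    -hessDet i j f q / (2 * pd j (pd j f) q), -pd d f q]

end FoldMatrix

namespace SmoothFn

variable {n m : ℕ} {U : Set (Fin n → ℝ)}

theorem contDiffOn_restParam (hU : IsOpen U) (H : SmoothFn U) (i j d : Fin n) :
    ContDiffOn ℝ ∞ (restParam i j d H) (U ∩ {q | pd j (pd j H) q ≠ 0}) := by
  have h1 := fun i => (H.contDiffOn_pd hU i).mono
    (inter_subset_left : U ∩ {q | pd j (pd j H) q ≠ 0} ⊆ U)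
  have h2 : ContDiffOn ℝ ∞ (fun q => -hessDet i j H q / (2 * pd j (pd j H) q))
      (U ∩ {q | pd j (pd j H) q ≠ 0}) :=
    ((H.contDiffOn_hessDet hU i j).mono inter_subset_left).neg.div
      (contDiffOn_const.mul ((H.contDiffOn_pd_pd hU j j).mono inter_subset_left))
      fun q hq => mul_ne_zero two_ne_zero hq.2
  rw [contDiffOn_pi]
  intro k
  fin_cases k <;> simp [restParam] <;> fun_prop

/-- The perturbations `a₀xᵢ + a₁xⱼ + a₂xᵢ² + a₃x_d`. -/
noncomputable abbrev restPoly (i j d : Fin n) : Fin 4 → MvPolynomial (Fin n) ℝ :=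
  ![.X i, .X j, .X i * .X i, .X d]

theorem pd_pd_perturb_restPoly (hU : IsOpen U) (H : SmoothFn U) {i j d : Fin n} (hij : i ≠ j) 
    (hjd : j ≠ d) (a : Fin 4 → ℝ) {q : Fin n → ℝ} (hq : q ∈ U) :
    pd j (pd j (H.perturb (restPoly i j d) a)) q = pd j (pd j H) q := by
  simp [H.pd_pd_perturb hU _ a _ _ hq, Fin.sum_univ_four, MvPolynomial.pderiv_X_of_ne hij,
    MvPolynomial.pderiv_X_of_ne hjd.symm]

/-- The perturbed equations are a triangular invertible system in `a - restParam`. This identifies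
both their solutions and, at a solution, the kernel of their differential. -/
theorem perturb_restPoly_eq (hU : IsOpen U) (H : SmoothFn U) {i j d : Fin n} (hij : i ≠ j) (hid : i ≠ d)
    (hjd : j ≠ d) (a : Fin 4 → ℝ) {q : Fin n → ℝ} (hq : q ∈ U)
    (hN : pd j (pd j H) q ≠ 0) :
    pd i (H.perturb (restPoly i j d) a) q =
        (a 0 - restParam i j d H q 0) + 2 * (a 2 - restParam i j d H q 2) * q i ∧
      pd j (H.perturb (restPoly i j d) a) q = a 1 - restParam i j d H q 1 ∧
      hessDet i j (H.perturb (restPoly i j d) a) q =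
        2 * (a 2 - restParam i j d H q 2) * pd j (pd j H) q ∧
      pd d (H.perturb (restPoly i j d) a) q = a 3 - restParam i j d H q 3 := by
  simp [hessDet, restParam, H.pd_perturb hU _ a _ hq,
    H.pd_pd_perturb hU _ a _ _ hq, Fin.sum_univ_four, MvPolynomial.pderiv_X_of_ne hij,
    MvPolynomial.pderiv_X_of_ne hij.symm, MvPolynomial.pderiv_X_of_ne hid,
    MvPolynomial.pderiv_X_of_ne hid.symm, MvPolynomial.pderiv_X_of_ne hjd,
    MvPolynomial.pderiv_X_of_ne hjd.symm]
  refine ⟨?_, ?_, ?_, ?_⟩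
  all_goals first | ring1 | (field_simp; ring)

theorem restParam_eq (hU : IsOpen U) (H : SmoothFn U) {i j d : Fin n} (hij : i ≠ j) (hid : i ≠ d)
    (hjd : j ≠ d) (a : Fin 4 → ℝ) {q : Fin n → ℝ} (hq : q ∈ U)
    (hN : pd j (pd j H) q ≠ 0) (e1 : pd i (H.perturb (restPoly i j d) a) q = 0)
    (e2 : pd j (H.perturb (restPoly i j d) a) q = 0)
    (e3 : hessDet i j (H.perturb (restPoly i j d) a) q = 0)
    (e4 : pd d (H.perturb (restPoly i j d) a) q = 0) : restParam i j d H q = a := by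
  obtain ⟨f1, f2, f3, f4⟩ := H.perturb_restPoly_eq hU hij hid hjd a hq hN
  rw [f1] at e1
  rw [f2] at e2
  rw [f3] at e3
  rw [f4] at e4
  have h2 : a 2 - restParam i j d H q 2 = 0 := by
    simpa [hN] using e3
  funext k
  fin_cases k
  · change restParam i j d H q 0 = a 0
    rw [h2] at e1
    linear_combination -e1
  · change restParam i j d H q 1 = a 1
    linear_combination -e2
  · change restParam i j d H q 2 = a 2
    linear_combination -h2
  · change restParam i j d H q 3 = a 3
    linear_combination -e4

/-- In at most three dimensions, parabolic points with `∂_d = 0` and `∂ⱼ² ≠ 0` generically do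
not occur. -/
theorem residual_not_rest (hU : IsOpen U) (hn : n < 4) {i j d : Fin n} (hij : i ≠ j)
    (hid : i ≠ d) (hjd : j ≠ d) :
    {H : SmoothFn U | ∀ q : U, pd j (pd j H) q ≠ 0 → ¬ (pd i H q = 0 ∧ pd j H q = 0 ∧
      hessDet i j H q = 0 ∧ pd d H q = 0)} ∈ residual (SmoothFn U) := by
  have hB : IsClosed {z : SmoothFn U × U | pd i z.1 z.2 = 0 ∧ pd j z.1 z.2 = 0 ∧
      hessDet i j z.1 z.2 = 0 ∧ pd d z.1 z.2 = 0} :=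
    (isClosed_eq (continuous_pd hU i) continuous_const).inter <|
    (isClosed_eq (continuous_pd hU j) continuous_const).inter <|
    (isClosed_eq (continuous_hessDet hU i j) continuous_const).inter
    (isClosed_eq (continuous_pd hU d) continuous_const)
  refine mem_residual_of_image hU hB (continuous_pd_pd hU j j) hn (restPoly i j d)
    fun H => ⟨_, _, H.isOpen_pd_pd_ne_zero hU j, H.contDiffOn_restParam hU i j d, ?_⟩
  rintro a ⟨q, hq⟩ hN ⟨e1, e2, e3, e4⟩
  have hN' : pd j (pd j H) q ≠ 0 := by
    rwa [← H.pd_pd_perturb_restPoly hU hij hjd a hq]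
  exact ⟨⟨hq, hN'⟩, H.restParam_eq hU hij hid hjd a hq hN' e1 e2 e3 e4⟩

theorem continuous_restMatrix (hU : IsOpen U) (i j d : Fin n) :
    Continuous fun z : SmoothFn U × U => restMatrix i j d z.1 z.2 := by
  refine continuous_matrix fun k l => ?_
  fin_cases k
  · exact continuous_pd_pd hU l i
  · exact continuous_pd_pd hU l j
  · exact continuous_hessDetDeriv hU i j l
  · exact continuous_pd_pd hU l d

theorem restMatrix_mulVec (hU : IsOpen U) (H : SmoothFn U) (i j d : Fin n) {q : Fin n → ℝ}
    (hq : q ∈ U) (w : Fin n → ℝ) :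
    (restMatrix i j d H q).mulVec w = ![fderiv ℝ (pd i H) q w, fderiv ℝ (pd j H) q w,
      fderiv ℝ (hessDet i j H) q w, fderiv ℝ (pd d H) q w] := by
  simp only [fderiv_apply_eq_sum_pd, H.pd_hessDet hU i j _ hq]
  funext k
  fin_cases k <;> simp [Matrix.mulVec, dotProduct, restMatrix, mul_comm]

/-- In four dimensions, the parabolic points with `∂_d = 0` and `∂ⱼ² ≠ 0` are generically
nondegenerate. -/
theorem residual_det_restMatrix {U : Set (Fin 4 → ℝ)} (hU : IsOpen U) {i j d : Fin 4} (hij : i ≠ j)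
    (hid : i ≠ d) (hjd : j ≠ d) :
    {H : SmoothFn U | ∀ q : U, pd j (pd j H) q ≠ 0 → ¬ (pd i H q = 0 ∧ pd j H q = 0 ∧
      hessDet i j H q = 0 ∧ pd d H q = 0 ∧ (restMatrix i j d H q).det = 0)} ∈
      residual (SmoothFn U) := by
  have hB : IsClosed {z : SmoothFn U × U | pd i z.1 z.2 = 0 ∧ pd j z.1 z.2 = 0 ∧
      hessDet i j z.1 z.2 = 0 ∧ pd d z.1 z.2 = 0 ∧ (restMatrix i j d z.1 z.2).det = 0} :=
    (isClosed_eq (continuous_pd hU i) continuous_const).inter <|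
    (isClosed_eq (continuous_pd hU j) continuous_const).inter <|
    (isClosed_eq (continuous_hessDet hU i j) continuous_const).inter <|
    (isClosed_eq (continuous_pd hU d) continuous_const).inter
    (isClosed_eq (continuous_restMatrix hU i j d).matrix_det continuous_const)
  refine mem_residual_of_perturb hU hB (continuous_pd_pd hU j j) (restPoly i j d) fun H => ?_
  set S := U ∩ {q | pd j (pd j H) q ≠ 0}
  have hS : IsOpen S := H.isOpen_pd_pd_ne_zero hU j
  have hΨ := H.contDiffOn_restParam hU i j d
  refine (dense_setOf_det_fderiv_ne_zero hS (hΨ.of_le (by simp))).mono ?_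
  rintro a ha ⟨q, hq⟩ hN ⟨e1, e2, e3, e4, e5⟩
  set H' := H.perturb (restPoly i j d) a
  have hN' : pd j (pd j H) q ≠ 0 := by
    rwa [← H.pd_pd_perturb_restPoly hU hij hjd a hq]
  have hqS : q ∈ S := ⟨hq, hN'⟩
  have hqa := H.restParam_eq hU hij hid hjd a hq hN' e1 e2 e3 e4
  -- `a` is a regular value of `restParam`; a kernel vector `w` of the matrix of the perturbed
  -- function will be shown to be killed by the differential of `restParam` at `q`.
  refine ha q hqS hqa ?_
  obtain ⟨w, hw0, hw⟩ := Matrix.exists_mulVec_eq_zero_iff.2 e5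
  rw [H'.restMatrix_mulVec hU i j d hq] at hw
  have w1 : fderiv ℝ (pd i H') q w = 0 := congrFun hw 0
  have w2 : fderiv ℝ (pd j H') q w = 0 := congrFun hw 1
  have w3 : fderiv ℝ (hessDet i j H') q w = 0 := congrFun hw 2
  have w4 : fderiv ℝ (pd d H') q w = 0 := congrFun hw 3
  have hd : DifferentiableAt ℝ (restParam i j d H) q :=
    (hΨ.contDiffAt (hS.mem_nhds hqS)).differentiableAt (by simp)
  have hk : ∀ k, HasFDerivAt (fun z => restParam i j d H z k)
      ((ContinuousLinearMap.proj k).comp (fderiv ℝ (restParam i j d H) q)) q :=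
    fun k => hasFDerivAt_pi'.1 hd.hasFDerivAt k
  have hev : ∀ᶠ z in 𝓝 q, z ∈ S := hS.mem_nhds hqS
  have hjj : HasFDerivAt (pd j (pd j H)) _ q :=
    (((H.contDiffOn_pd_pd hU j j).contDiffAt (hU.mem_nhds hq)).differentiableAt
      (by simp)).hasFDerivAt
  have g1 : pd i H' =ᶠ[𝓝 q] fun z => (a 0 - restParam i j d H z 0) +
      2 * (a 2 - restParam i j d H z 2) * z i := by
    filter_upwards [hev] with z hz
    exact (H.perturb_restPoly_eq hU hij hid hjd a hz.1 hz.2).1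
  have g2 : pd j H' =ᶠ[𝓝 q] fun z => a 1 - restParam i j d H z 1 := by
    filter_upwards [hev] with z hz
    exact (H.perturb_restPoly_eq hU hij hid hjd a hz.1 hz.2).2.1
  have g3 : hessDet i j H' =ᶠ[𝓝 q] fun z =>
      2 * (a 2 - restParam i j d H z 2) * pd j (pd j H) z := by
    filter_upwards [hev] with z hz
    exact (H.perturb_restPoly_eq hU hij hid hjd a hz.1 hz.2).2.2.1
  have g4 : pd d H' =ᶠ[𝓝 q] fun z => a 3 - restParam i j d H z 3 := by
    filter_upwards [hev] with z hz
    exact (H.perturb_restPoly_eq hU hij hid hjd a hz.1 hz.2).2.2.2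
  rw [g1.fderiv_eq, (((hk 0).const_sub (a 0)).fun_add ((((hk 2).const_sub (a 2)).const_mul 2).fun_mul
    (hasFDerivAt_apply i q))).fderiv] at w1
  rw [g2.fderiv_eq, ((hk 1).const_sub (a 1)).fderiv] at w2
  rw [g3.fderiv_eq, ((((hk 2).const_sub (a 2)).const_mul 2).fun_mul hjj).fderiv] at w3
  rw [g4.fderiv_eq, ((hk 3).const_sub (a 3)).fderiv] at w4
  -- Since `restParam` equals `a` at `q`, the product-rule terms that differentiate the other factor
  -- drop out.
  simp [hqa, hN'] at w1 w2 w3 w4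
  rw [w3] at w1
  by_contra hdet
  refine hw0 ?_
  have hinj : Function.Injective (fderiv ℝ (restParam i j d H) q) :=
    ((fderiv ℝ (restParam i j d H) q).toLinearMap.equivOfDetNeZero hdet).injective
  refine hinj ?_
  rw [map_zero]
  funext k
  fin_cases k
  · simpa using w1
  · exact w2
  · exact w3
  · exact w4

end SmoothFn

/-! ### Regular equations and submanifolds. -/

theorem fderiv_apply_coord {n m : ℕ} {g : (Fin n → ℝ) → Fin m → ℝ} {q : Fin n → ℝ}
    (hg : DifferentiableAt ℝ g q) (w : Fin n → ℝ) (k : Fin m) :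
    fderiv ℝ g q w k = fderiv ℝ (fun z => g z k) q w := by
  rw [(hasFDerivAt_pi'.1 hg.hasFDerivAt k).fderiv]
  rfl

/-- Independence of the rows: a proper range is annihilated by a nonzero functional, whose
coefficients form a relation between the component differentials. -/
theorem surjective_fderiv_of_forall {n m : ℕ} {g : (Fin n → ℝ) → Fin m → ℝ} {q : Fin n → ℝ}
    (hg : DifferentiableAt ℝ g q)
    (h : ∀ c : Fin m → ℝ, (∀ l, ∑ k, c k * pd l (fun z => g z k) q = 0) → c = 0) :
    Function.Surjective (fderiv ℝ g q) := by
  by_contra hs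
  have hlt : (fderiv ℝ g q).toLinearMap.range < ⊤ :=
    lt_top_iff_ne_top.2 fun ht => hs (LinearMap.range_eq_top.1 ht)
  obtain ⟨f, hf0, hf⟩ := Submodule.exists_le_ker_of_lt_top _ hlt
  have hsum : ∀ v, f v = ∑ k, f (Pi.single k 1) * v k := by
    intro v
    conv_lhs => rw [← Finset.univ_sum_single v]
    rw [map_sum]
    refine Finset.sum_congr rfl fun k _ => ?_
    have : (Pi.single k (v k) : Fin m → ℝ) = v k • Pi.single k 1 := by
      rw [← Pi.single_smul]; simp
    rw [this, map_smul, smul_eq_mul, mul_comm]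
  have h0 := h (fun k => f (Pi.single k 1)) fun l => by
    have h1 : f (fderiv ℝ g q (Pi.single l 1)) = 0 := hf ⟨_, rfl⟩
    rw [hsum] at h1
    simpa only [fderiv_apply_coord hg, pd] using h1
  exact hf0 (LinearMap.ext fun v => by simp [hsum v, fun k => congrFun h0 k])

/-- Composing with a fixed right inverse of the differential at `q` gives a determinant that is `1`
at `q`, hence nonzero nearby. -/
theorem isOpen_setOf_surjective_fderiv {n m : ℕ} {U : Set (Fin n → ℝ)} (hU : IsOpen U)
    {g : (Fin n → ℝ) → Fin m → ℝ} (hg : ContDiffOn ℝ ∞ g U) :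
    IsOpen {q ∈ U | Function.Surjective (fderiv ℝ g q)} := by
  have hc : ContinuousOn (fderiv ℝ g) U :=
    (hg.fderiv_of_isOpen hU (m := ∞) (by simp)).continuousOn
  rw [isOpen_iff_mem_nhds]
  rintro q ⟨hq, hs⟩
  obtain ⟨R, hR⟩ := (fderiv ℝ g q).toLinearMap.exists_rightInverse_of_surjective
    (LinearMap.range_eq_top.2 hs)
  set R' := LinearMap.toContinuousLinearMap R
  have hdet : ContinuousAt (fun z => ((fderiv ℝ g z).comp R').det) q :=
    ContinuousLinearMap.continuous_det.continuousAt.comp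
      ((hc.continuousAt (hU.mem_nhds hq)).clm_comp continuousAt_const)
  have h1 : ((fderiv ℝ g q).comp R').det = 1 := by
    have : ((fderiv ℝ g q).comp R') = ContinuousLinearMap.id ℝ _ := by
      ext1 v
      exact LinearMap.congr_fun hR v
    rw [this]
    simp [ContinuousLinearMap.det]
  have hne : ∀ᶠ z in 𝓝 q, ((fderiv ℝ g z).comp R').det ≠ 0 :=
    hdet.eventually_ne (by rw [h1]; exact one_ne_zero)
  filter_upwards [hne, hU.mem_nhds hq] with z hz hzU
  refine ⟨hzU, fun v => ?_⟩
  obtain ⟨u, hu⟩ := (((fderiv ℝ g z).comp R').toLinearMap.equivOfDetNeZero hz).surjective v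
  exact ⟨R' u, hu⟩

theorem isSubmanifold_of_regular {n m k : ℕ} (hk : k + m = n) {U : Set (Fin n → ℝ)}
    (hU : IsOpen U) {g : (Fin n → ℝ) → Fin m → ℝ} (hg : ContDiffOn ℝ ∞ g U)
    {S : Set (Fin n → ℝ)} (hS : S = {q ∈ U | g q = 0})
    (hreg : ∀ q ∈ S, Function.Surjective (fderiv ℝ g q)) : IsSubmanifold k S := by
  refine ⟨m, hk, fun p hp => ⟨_, isOpen_setOf_surjective_fderiv hU hg, ⟨?_, hreg p hp⟩, g,
    hg.mono fun q hq => hq.1, fun q hq => hq.2, ?_⟩⟩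
  · rw [hS] at hp
    exact hp.1
  · rw [hS]
    ext q
    constructor
    · rintro ⟨h1, h2⟩
      exact ⟨h2, h1.2⟩
    · rintro ⟨h1, h2⟩
      exact ⟨⟨h1.1, h2⟩, h1⟩

/-- The left-hand sides of the equations of `P ∩ T`. -/
noncomputable def restEq {n : ℕ} (H : (Fin (n + 3) → ℝ) → ℝ) (q : Fin (n + 3) → ℝ) : Fin 4 → ℝ :=
  ![pd 0 H q, pd 1 H q, hessDet 0 1 H q, pd 2 H q]

/-! ### Transversality as injectivity of the differential of `restEq`. -/

namespace SmoothFn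

theorem hessDet_comm {n : ℕ} {U : Set (Fin n → ℝ)} (hU : IsOpen U) (H : SmoothFn U) (i j : Fin n)
    {q : Fin n → ℝ} (hq : q ∈ U) : hessDet i j H q = hessDet j i H q := by
  rw [hessDet, hessDet, pd_comm hU H.2 i j q hq]
  ring

theorem hessDetDeriv_comm {n : ℕ} {U : Set (Fin n → ℝ)} (hU : IsOpen U) (H : SmoothFn U)
    (i j l : Fin n) {q : Fin n → ℝ} (hq : q ∈ U) :
    hessDetDeriv i j l H q = hessDetDeriv j i l H q := by
  rw [← H.pd_hessDet hU i j l hq, ← H.pd_hessDet hU j i l hq,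
    pd_congr hU (fun q hq => H.hessDet_comm hU i j hq) l q hq]

theorem det_normalHess {n : ℕ} {U : Set (Fin (n + 2) → ℝ)} (hU : IsOpen U) (H : SmoothFn U)
    {q : Fin (n + 2) → ℝ} (hq : q ∈ U) : (normalHess H q).det = hessDet 0 1 H q := by
  rw [normalHess, Matrix.det_fin_two_of, hessDet, pd_comm hU H.2 1 0 q hq]
  ring

variable {U : Set (Fin 4 → ℝ)}

theorem mem_inter_iff_restEq (hU : IsOpen U) (H : SmoothFn U) {q : Fin 4 → ℝ} (hq : q ∈ U) :
    q ∈ parabolicSet U H ∩ restSet U H ↔ restEq (n := 1) H q = 0 := by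
  have hd := H.det_normalHess (n := 2) hU hq
  simp [parabolicSet, fixedSet, restSet, fixEq, restEq, and_assoc]
  rw [hd]
  tauto

theorem contDiffOn_restEq (hU : IsOpen U) (H : SmoothFn U) :
    ContDiffOn ℝ ∞ (restEq (n := 1) H) U := by
  have h1 := H.contDiffOn_pd hU
  have h2 := H.contDiffOn_hessDet hU
  rw [contDiffOn_pi]
  intro k
  fin_cases k <;> simp [restEq] <;> fun_prop

theorem contDiffOn_parEq (hU : IsOpen U) (H : SmoothFn U) : ContDiffOn ℝ ∞ (parEq H) U := by
  have h1 := H.contDiffOn_pd hU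
  have h2 : ContDiffOn ℝ ∞ (fun q => (normalHess (n := 2) H q).det) U :=
    (H.contDiffOn_hessDet hU 0 1).congr fun q hq => H.det_normalHess hU hq
  rw [contDiffOn_pi]
  intro k
  fin_cases k <;> simp [parEq] <;> fun_prop

theorem differentiableAt_restEq (hU : IsOpen U) (H : SmoothFn U) {q : Fin 4 → ℝ} (hq : q ∈ U) :
    DifferentiableAt ℝ (restEq (n := 1) H) q :=
  ((H.contDiffOn_restEq hU).contDiffAt (hU.mem_nhds hq)).differentiableAt (by simp)

theorem differentiableAt_parEq (hU : IsOpen U) (H : SmoothFn U) {q : Fin 4 → ℝ} (hq : q ∈ U) :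
    DifferentiableAt ℝ (parEq H) q :=
  ((H.contDiffOn_parEq hU).contDiffAt (hU.mem_nhds hq)).differentiableAt (by simp)

theorem fderiv_restEq_apply (hU : IsOpen U) (H : SmoothFn U) {q : Fin 4 → ℝ} (hq : q ∈ U)
    (w : Fin 4 → ℝ) :
    fderiv ℝ (restEq (n := 1) H) q w = (restMatrix 0 1 2 H q).mulVec w := by
  rw [H.restMatrix_mulVec hU 0 1 2 hq]
  funext k
  rw [fderiv_apply_coord (H.differentiableAt_restEq hU hq)]
  fin_cases k <;> rfl

theorem fderiv_parEq_apply (hU : IsOpen U) (H : SmoothFn U) {q : Fin 4 → ℝ} (hq : q ∈ U)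
    (w : Fin 4 → ℝ) (k : Fin 3) :
    fderiv ℝ (parEq H) q w k = fderiv ℝ (restEq (n := 1) H) q w k.castSucc := by
  rw [fderiv_apply_coord (H.differentiableAt_parEq hU hq),
    fderiv_apply_coord (H.differentiableAt_restEq hU hq)]
  have : (fun z => parEq H z k) =ᶠ[𝓝 q] fun z => restEq (n := 1) H z k.castSucc := by
    filter_upwards [hU.mem_nhds hq] with z hz
    fin_cases k
    · rfl
    · rfl
    · exact H.det_normalHess hU hz
  rw [this.fderiv_eq]

theorem fderiv_pd_two_apply (hU : IsOpen U) (H : SmoothFn U) {q : Fin 4 → ℝ} (hq : q ∈ U)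
    (w : Fin 4 → ℝ) :
    fderiv ℝ (pd 2 H) q w = fderiv ℝ (restEq (n := 1) H) q w 3 := by
  rw [fderiv_apply_coord (H.differentiableAt_restEq hU hq)]
  rfl

/-- The differential of `restEq` at a nondegenerate point is an equivalence. -/
theorem exists_equiv_of_injective (hU : IsOpen U) (H : SmoothFn U) {q : Fin 4 → ℝ} (hq : q ∈ U)
    (hinj : Function.Injective (fderiv ℝ (restEq (n := 1) H) q)) :
    ∃ e : (Fin 4 → ℝ) ≃L[ℝ] (Fin 4 → ℝ), (e : (Fin 4 → ℝ) →L[ℝ] (Fin 4 → ℝ)) =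
      fderiv ℝ (restEq (n := 1) H) q ∧
      HasStrictFDerivAt (restEq (n := 1) H) (e : (Fin 4 → ℝ) →L[ℝ] (Fin 4 → ℝ)) q := by
  refine ⟨(LinearEquiv.ofInjectiveEndo (fderiv ℝ (restEq (n := 1) H) q).toLinearMap
    hinj).toContinuousLinearEquiv, ?_, ?_⟩
  · ext1 w
    rfl
  · exact ((H.contDiffOn_restEq hU).contDiffAt (hU.mem_nhds hq)).hasStrictFDerivAt (by simp)

/-- In the local coordinates given by `restEq`, `P` is the last coordinate axis and `T` is the
complementary coordinate hyperplane. The local inverse carries straight lines in them to the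
required curves. -/
theorem isTransverseParabolicPoint_of_injective (hU : IsOpen U) (H : SmoothFn U) {q : Fin 4 → ℝ}
    (hq : q ∈ parabolicSet U H ∩ restSet U H)
    (hinj : Function.Injective (fderiv ℝ (restEq (n := 1) H) q)) :
    IsTransverseParabolicPoint U H q := by
  have hqU : q ∈ U := hq.2.1
  have hq0 := (H.mem_inter_iff_restEq hU hqU).1 hq
  obtain ⟨e, he, hs⟩ := H.exists_equiv_of_injective hU hqU hinj
  have hew : ∀ w, fderiv ℝ (restEq (n := 1) H) q w = e w := fun w => by rw [← he]; rfl
  have hcurve : ∀ v : Fin 4 → ℝ, ∃ γ : ℝ → Fin 4 → ℝ, γ 0 = q ∧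
      (∀ᶠ t in 𝓝 0, γ t ∈ U ∧ restEq (n := 1) H (γ t) = t • v) ∧
      HasDerivAt γ (e.symm v) 0 := by
    intro v
    have hline : HasDerivAt (fun t : ℝ => t • v) v 0 := by
      simpa using (hasDerivAt_id (0 : ℝ)).smul_const v
    -- The base point is written `0 • v` to match the line `t • v` at `t = 0`.
    have hinv : HasFDerivAt (hs.localInverse _ _ _) (e.symm : (Fin 4 → ℝ) →L[ℝ] (Fin 4 → ℝ))
        ((0 : ℝ) • v) := by
      have := hs.to_localInverse.hasFDerivAt
      rwa [hq0, ← zero_smul ℝ v] at this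
    have hγ0 : hs.localInverse _ _ _ ((0 : ℝ) • v) = q := by
      have := hs.localInverse_apply_image
      rwa [hq0, ← zero_smul ℝ v] at this
    have hder := hinv.comp_hasDerivAt 0 hline
    refine ⟨fun t => hs.localInverse _ _ _ (t • v), hγ0, ?_, hder⟩
    have h1 : ∀ᶠ t in 𝓝 (0 : ℝ), hs.localInverse _ _ _ (t • v) ∈ U :=
      hder.continuousAt.eventually_mem (by simpa only [Function.comp_def, hγ0] using hU.mem_nhds hqU)
    have h2 := hs.eventually_right_inverse
    rw [hq0, ← zero_smul ℝ v] at h2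
    exact h1.and (hline.continuousAt.eventually h2)
  refine ⟨hq.1, hq.2, ?_, ?_, ?_⟩
  · intro u
    refine ⟨e.symm ![u 0, u 1, u 2, 0], ?_⟩
    funext k
    rw [H.fderiv_parEq_apply hU hqU, hew, e.apply_symm_apply]
    fin_cases k <;> rfl
  · intro h0
    have := H.fderiv_pd_two_apply hU hqU (e.symm (Pi.single 3 1))
    rw [hew, e.apply_symm_apply, h0] at this
    simp at this
  · rw [TransverseAt, eq_top_iff]
    intro w _
    set v := e w
    have hw : w = e.symm (Pi.single 3 (v 3)) + e.symm (v - Pi.single 3 (v 3)) := by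
      rw [← map_add]
      simp [v]
    rw [hw]
    refine Submodule.add_mem_sup (Submodule.subset_span ?_) (Submodule.subset_span ?_)
    · obtain ⟨γ, h0, h1, h2⟩ := hcurve (Pi.single 3 (v 3))
      refine ⟨γ, h0, ?_, h2⟩
      filter_upwards [h1] with t ht
      have e0 := congrFun ht.2 0
      have e1 := congrFun ht.2 1
      have e2 := congrFun ht.2 2
      simp [restEq] at e0 e1 e2
      refine ⟨⟨ht.1, ?_⟩, ?_⟩
      · simp [fixEq, e0, e1]
      · rw [H.det_normalHess hU ht.1, e2]
    · obtain ⟨γ, h0, h1, h2⟩ := hcurve (v - Pi.single 3 (v 3))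
      refine ⟨γ, h0, ?_, h2⟩
      filter_upwards [h1] with t ht
      have e3 := congrFun ht.2 3
      simp [restEq] at e3
      exact ⟨ht.1, e3⟩

theorem fderiv_eq_zero_of_mem_tangentSpaceOf {n m : ℕ} {S : Set (Fin n → ℝ)} {p : Fin n → ℝ}
    {g : (Fin n → ℝ) → Fin m → ℝ} (hg : DifferentiableAt ℝ g p) (hS : ∀ q ∈ S, g q = 0)
    {w : Fin n → ℝ} (hw : w ∈ tangentSpaceOf S p) : fderiv ℝ g p w = 0 := by
  have hle : tangentSpaceOf S p ≤ (fderiv ℝ g p).toLinearMap.ker := by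
    refine Submodule.span_le.2 ?_
    rintro w ⟨γ, h0, h1, h2⟩
    subst h0
    have h3 := hg.hasFDerivAt.comp_hasDerivAt 0 h2
    have h4 : g ∘ γ =ᶠ[𝓝 0] fun _ => 0 := by
      filter_upwards [h1] with t ht using hS _ ht
    exact h3.unique ((hasDerivAt_const (0 : ℝ) (0 : Fin m → ℝ)).congr_of_eventuallyEq h4)
  exact hle hw

/-- The kernel of the differential of `parEq` is a line containing the tangent space of `P`.
Transversality forces the differential of `∂_D H` to be nonzero on it, because that differential
vanishes on the tangent space of `T` but not identically. -/
theorem injective_of_isTransverseParabolicPoint (hU : IsOpen U) (H : SmoothFn U) {q : Fin 4 → ℝ}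
    (h : IsTransverseParabolicPoint U H q) :
    Function.Injective (fderiv ℝ (restEq (n := 1) H) q) := by
  have hqU : q ∈ U := h.mem_T.1
  rw [injective_iff_map_eq_zero]
  intro w hw
  have hker : Module.finrank ℝ (fderiv ℝ (parEq H) q).toLinearMap.ker = 1 := by
    have h1 := (fderiv ℝ (parEq H) q).toLinearMap.finrank_range_add_finrank_ker
    rw [LinearMap.range_eq_top.2 h.regular_P, finrank_top] at h1
    simp at h1
    omega
  have hwP : w ∈ (fderiv ℝ (parEq H) q).toLinearMap.ker := by
    change fderiv ℝ (parEq H) q w = 0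
    funext k
    rw [H.fderiv_parEq_apply hU hqU, hw]
    rfl
  have hwT : fderiv ℝ (pd 2 H) q w = 0 := by
    rw [H.fderiv_pd_two_apply hU hqU, hw]
    rfl
  obtain ⟨u, hu⟩ : ∃ u, fderiv ℝ (pd 2 H) q u ≠ 0 := by
    by_contra! h0
    exact h.regular_T (ContinuousLinearMap.ext h0)
  have hutop : u ∈ tangentSpaceOf (parabolicSet U H) q ⊔ tangentSpaceOf (restSet U H) q := by
    rw [show _ ⊔ _ = ⊤ from h.transverse]
    trivial
  obtain ⟨u1, hu1, u2, hu2, rfl⟩ := Submodule.mem_sup.1 hutop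
  have hu1P : u1 ∈ (fderiv ℝ (parEq H) q).toLinearMap.ker := by
    refine fderiv_eq_zero_of_mem_tangentSpaceOf (H.differentiableAt_parEq hU hqU) ?_ hu1
    rintro z ⟨⟨_, hz1⟩, hz2⟩
    simp [fixEq] at hz1
    simp [parEq, hz1, hz2]
  have hd2 : DifferentiableAt ℝ (pd 2 H) q :=
    ((H.contDiffOn_pd hU 2).contDiffAt (hU.mem_nhds hqU)).differentiableAt (by simp)
  have hu2T : fderiv ℝ (pd 2 H) q u2 = 0 := by
    have hg : DifferentiableAt ℝ (fun z (_ : Fin 1) => pd 2 H z) q :=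
      differentiableAt_pi.2 fun _ => hd2
    have := fderiv_eq_zero_of_mem_tangentSpaceOf hg
      (fun z (hz : z ∈ restSet U H) => funext fun _ => hz.2) hu2
    have := congrFun this 0
    rwa [fderiv_apply_coord hg] at this
  rw [map_add, hu2T, add_zero] at hu
  have hu10 : (⟨u1, hu1P⟩ : (fderiv ℝ (parEq H) q).toLinearMap.ker) ≠ 0 := by
    intro h0
    have h1 : u1 = 0 := congrArg Subtype.val h0
    exact hu (by rw [h1, map_zero])
  obtain ⟨c, hc⟩ := (finrank_eq_one_iff_of_nonzero' _ hu10).1 hker ⟨w, hwP⟩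
  have hc' : c • u1 = w := congrArg Subtype.val hc
  rw [← hc', map_smul, smul_eq_mul, mul_eq_zero, or_iff_left hu] at hwT
  rw [← hc', hwT, zero_smul]

theorem exists_nhds_inter_eq_singleton (hU : IsOpen U) (H : SmoothFn U) {q : Fin 4 → ℝ}
    (hq : q ∈ parabolicSet U H ∩ restSet U H)
    (hinj : Function.Injective (fderiv ℝ (restEq (n := 1) H) q)) :
    ∃ W ∈ 𝓝 q, W ∩ (parabolicSet U H ∩ restSet U H) = {q} := by
  have hqU : q ∈ U := hq.2.1
  obtain ⟨e, -, hs⟩ := H.exists_equiv_of_injective hU hqU hinj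
  refine ⟨_, hs.eventually_left_inverse, ?_⟩
  ext z
  constructor
  · rintro ⟨hz1, hz2⟩
    have hz0 := (H.mem_inter_iff_restEq hU hz2.2.1).1 hz2
    have hq0 := (H.mem_inter_iff_restEq hU hqU).1 hq
    have hz1' : hs.localInverse _ _ _ (restEq (n := 1) H z) = z := hz1
    rw [hz0, ← hq0, hs.localInverse_apply_image] at hz1'
    exact hz1'.symm
  · rintro rfl
    exact ⟨hs.localInverse_apply_image, hq⟩

end SmoothFn

/-! ### Persistence under small perturbations of the family. -/

namespace SmoothFn

variable {U : Set (Fin 4 → ℝ)}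

theorem continuous_restEq (hU : IsOpen U) :
    Continuous fun z : SmoothFn U × U => restEq (n := 1) z.1 z.2 := by
  refine continuous_pi fun k => ?_
  fin_cases k
  · exact continuous_pd hU 0
  · exact continuous_pd hU 1
  · exact continuous_hessDet hU 0 1
  · exact continuous_pd hU 2

theorem continuous_fderiv_restEq (hU : IsOpen U) :
    Continuous fun z : SmoothFn U × U => fderiv ℝ (restEq (n := 1) z.1) z.2 := by
  rw [continuous_clm_apply]
  intro w
  have : (fun z : SmoothFn U × U => fderiv ℝ (restEq (n := 1) z.1) z.2 w) =
      fun z => (restMatrix 0 1 2 z.1 z.2).mulVec w :=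
    funext fun z => z.1.fderiv_restEq_apply hU z.2.2 w
  rw [this]
  exact (continuous_restMatrix hU 0 1 2).matrix_mulVec continuous_const

theorem finite_of_isolated {n : ℕ} {K S : Set (Fin n → ℝ)} (hK : IsCompact K)
    (hS : ∀ q ∈ K, ∃ W ∈ 𝓝 q, (W ∩ S).Finite) : (K ∩ S).Finite := by
  choose! W hW hfin using hS
  obtain ⟨t, htK, ht⟩ := hK.elim_nhds_subcover W hW
  refine (t.finite_toSet.biUnion fun q hq => hfin q (htK q hq)).subset ?_
  rintro q ⟨hqK, hqS⟩
  obtain ⟨x, hx, hqx⟩ := mem_iUnion₂.1 (ht hqK)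
  exact mem_iUnion₂.2 ⟨x, hx, hqx, hqS⟩

/-- A quantitative inverse function theorem on a ball of prescribed radius, so that one ball serves
all nearby functions. With `c` half of `‖e⁻¹‖⁻¹`, the map is injective on the ball and its image
covers the ball of radius `(‖e⁻¹‖⁻¹ - c) r = c r` about `f q`. -/
theorem exists_unique_zero_of_fderiv_near {E : Type*} [NormedAddCommGroup E] [NormedSpace ℝ E]
    [CompleteSpace E] [Nontrivial E] {f : E → E} {e : E ≃L[ℝ] E} {c : NNReal}
    (hc : c = ‖(e.symm : E →L[ℝ] E)‖₊⁻¹ / 2) {q : E} {r : ℝ} (hr : 0 ≤ r)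
    (hf : ∀ z ∈ Metric.closedBall q r, DifferentiableAt ℝ f z)
    (hD : ∀ z ∈ Metric.closedBall q r, ‖fderiv ℝ f z - (e : E →L[ℝ] E)‖ ≤ c)
    (hq : ‖f q‖ ≤ c * r) :
    ∃ q' ∈ Metric.closedBall q r, f q' = 0 ∧ Function.Injective (fderiv ℝ f q') ∧
      ∀ z ∈ Metric.closedBall q r, f z = 0 → z = q' := by
  have hN := e.nnnorm_symm_pos
  have hcN : c < ‖(e.symm : E →L[ℝ] E)‖₊⁻¹ := by
    rw [hc]
    exact NNReal.half_lt_self (by positivity)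
  have hcNr : (‖(e.symm : E →L[ℝ] E)‖₊ : ℝ)⁻¹ - c = c := by
    rw [hc]
    push_cast
    ring
  have happ : ApproximatesLinearOn f (e : E →L[ℝ] E) (Metric.closedBall q r) c := by
    intro x hx y hy
    exact (convex_closedBall q r).norm_image_sub_le_of_norm_hasFDerivWithin_le'
      (fun z hz => (hf z hz).hasFDerivAt.hasFDerivWithinAt) hD hy hx
  obtain ⟨q', hq'W, hq'0⟩ : ∃ q' ∈ Metric.closedBall q r, f q' = 0 := by
    refine happ.surjOn_closedBall_of_nonlinearRightInverse e.toNonlinearRightInverse hr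
      Subset.rfl ?_
    rw [mem_closedBall_iff_norm, zero_sub, norm_neg]
    change _ ≤ ((‖(e.symm : E →L[ℝ] E)‖₊ : ℝ)⁻¹ - c) * r
    rwa [hcNr]
  refine ⟨q', hq'W, hq'0, ?_, fun z hz hz0 =>
    happ.injOn (Or.inr hcN) hz hq'W (hz0.trans hq'0.symm)⟩
  rw [injective_iff_map_eq_zero]
  intro w hw
  by_contra hw0
  have hpos : 0 < ‖w‖ := norm_pos_iff.2 hw0
  have h1 : ‖e w‖ ≤ c * ‖w‖ := by
    have h2 := (fderiv ℝ f q' - (e : E →L[ℝ] E)).le_opNorm w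
    have h3 : (fderiv ℝ f q' - (e : E →L[ℝ] E)) w = -e w := by
      change fderiv ℝ f q' w - e w = _
      rw [hw, zero_sub]
    rw [h3, norm_neg] at h2
    exact h2.trans (mul_le_mul_of_nonneg_right (hD q' hq'W) (norm_nonneg w))
  have h4 : ‖w‖ ≤ ‖(e.symm : E →L[ℝ] E)‖₊ * ‖e w‖ := by
    have := (e.symm : E →L[ℝ] E).le_opNorm (e w)
    simpa using this
  have h5 : (‖(e.symm : E →L[ℝ] E)‖₊ : ℝ) * (c * ‖w‖) = ‖w‖ / 2 := by
    have hN0 : (‖(e.symm : E →L[ℝ] E)‖₊ : ℝ) ≠ 0 := by exact_mod_cast hN.ne'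
    rw [hc, NNReal.coe_div, NNReal.coe_inv, NNReal.coe_ofNat]
    field_simp
  have h6 := mul_le_mul_of_nonneg_left h1 ‖(e.symm : E →L[ℝ] E)‖₊.2
  exact absurd (h4.trans (h6.trans_eq h5)) (by linarith)

theorem exists_nhds_persist (hU : IsOpen U) (H : SmoothFn U) {q : Fin 4 → ℝ}
    (h : IsTransverseParabolicPoint U H q) {V : Set (Fin 4 → ℝ)} (hV : V ∈ 𝓝 q) :
    ∃ W ∈ 𝓝 q, W ⊆ V ∧ ∀ᶠ H' : SmoothFn U in 𝓝 H,
      ∃ q' ∈ W, IsTransverseParabolicPoint U H' q' ∧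
        W ∩ (parabolicSet U H' ∩ restSet U H') = {q'} := by
  have hqU : q ∈ U := h.mem_T.1
  have hq0 := (H.mem_inter_iff_restEq hU hqU).1 ⟨h.mem_P, h.mem_T⟩
  obtain ⟨e, he, -⟩ := H.exists_equiv_of_injective hU hqU
    (H.injective_of_isTransverseParabolicPoint hU h)
  obtain ⟨c, hc⟩ : ∃ c : NNReal, c = ‖(e.symm : (Fin 4 → ℝ) →L[ℝ] (Fin 4 → ℝ))‖₊⁻¹ / 2 := ⟨_, rfl⟩
  have hc0 : 0 < c := by
    rw [hc]
    exact half_pos (inv_pos.2 e.nnnorm_symm_pos)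
  -- Joint continuity in function and point yields a product neighbourhood, hence a radius `r`
  -- independent of `H'`.
  have hnear : ∀ᶠ z : SmoothFn U × U in 𝓝 (H, ⟨q, hqU⟩),
      ‖fderiv ℝ (restEq (n := 1) z.1) z.2 - (e : (Fin 4 → ℝ) →L[ℝ] (Fin 4 → ℝ))‖ < c := by
    refine ((continuous_fderiv_restEq hU).sub continuous_const).norm.continuousAt.eventually_lt
      continuousAt_const ?_
    change ‖fderiv ℝ (restEq (n := 1) H) q - _‖ < _
    rw [he, sub_self, norm_zero]
    exact hc0
  rw [nhds_prod_eq] at hnear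
  obtain ⟨pa, hpa, pb, hpb, hp⟩ := eventually_prod_iff.1 hnear
  rw [nhds_subtype_eq_comap, eventually_comap] at hpb
  obtain ⟨r, hr, hrW⟩ := Metric.nhds_basis_closedBall.mem_iff.1
    (inter_mem (inter_mem hV (hU.mem_nhds hqU)) hpb)
  have hWU : Metric.closedBall q r ⊆ U := fun z hz => (hrW hz).1.2
  refine ⟨Metric.closedBall q r, Metric.closedBall_mem_nhds q hr, fun z hz => (hrW hz).1.1, ?_⟩
  have hsmall : ∀ᶠ H' : SmoothFn U in 𝓝 H, ‖restEq (n := 1) H' q‖ < c * r := by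
    refine ((continuous_restEq hU).comp (continuous_id.prodMk
      (continuous_const (y := (⟨q, hqU⟩ : U))))).norm.continuousAt.eventually_lt
      continuousAt_const ?_
    change ‖restEq (n := 1) H q‖ < _
    rw [hq0, norm_zero]
    exact mul_pos hc0 hr
  filter_upwards [hpa, hsmall] with H' hH' hsm
  obtain ⟨q', hq'W, hq'0, hinj, huniq⟩ := exists_unique_zero_of_fderiv_near hc hr.le
    (fun z hz => H'.differentiableAt_restEq hU (hWU hz))
    (fun z hz => (hp hH' ((hrW hz).2 ⟨z, hWU hz⟩ rfl)).le) hsm.le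
  have hq' := (H'.mem_inter_iff_restEq hU (hWU hq'W)).2 hq'0
  refine ⟨q', hq'W, H'.isTransverseParabolicPoint_of_injective hU hq' hinj, ?_⟩
  ext z
  constructor
  · rintro ⟨hzW, hz⟩
    exact huniq z hzW ((H'.mem_inter_iff_restEq hU hz.2.1).1 hz)
  · rintro rfl
    exact ⟨hq'W, hq'⟩

/-! ### Existence -/

theorem exists_isTransverseParabolicPoint (hU : IsOpen U) {q : Fin 4 → ℝ} (hq : q ∈ U) :
    ∃ H : SmoothFn U, IsTransverseParabolicPoint U H q := by
  -- The fold `v² + x³ + xc + D²` centred at `q`: the four equations are `3x² + c`, `2v`, `12x`,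
  -- `2D`, with independent differentials at the centre.
  set P : MvPolynomial (Fin 4) ℝ :=
    (.X 1 - .C (q 1)) * (.X 1 - .C (q 1)) +
      (.X 0 - .C (q 0)) * (.X 0 - .C (q 0)) * (.X 0 - .C (q 0)) +
      (.X 0 - .C (q 0)) * (.X 3 - .C (q 3)) + (.X 2 - .C (q 2)) * (.X 2 - .C (q 2)) with hP
  set H : SmoothFn U := ⟨fun z => MvPolynomial.eval z P, P.contDiff_eval.contDiffOn⟩
  have hpd : ∀ (i : Fin 4) (Q : MvPolynomial (Fin 4) ℝ), pd i (fun z => MvPolynomial.eval z Q) =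
      fun z => MvPolynomial.eval z (MvPolynomial.pderiv i Q) := fun i Q => funext (pd_eval Q i)
  have hH : (H : (Fin 4 → ℝ) → ℝ) = fun z => MvPolynomial.eval z P := rfl
  clear_value P
  refine ⟨H, H.isTransverseParabolicPoint_of_injective hU
    ((H.mem_inter_iff_restEq hU hq).2 ?_) ?_⟩
  · funext k
    fin_cases k <;> simp only [restEq, hessDet, hH, hpd] <;> simp [hP, MvPolynomial.pderiv_X]
  · rw [injective_iff_map_eq_zero]
    intro w hw
    rw [H.fderiv_restEq_apply hU hq] at hw
    simp only [restMatrix, hessDetDeriv, hH, hpd] at hw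
    have e0 := congrFun hw 0
    have e1 := congrFun hw 1
    have e2 := congrFun hw 2
    have e3 := congrFun hw 3
    simp [hP, MvPolynomial.pderiv_X, Matrix.mulVec, dotProduct, Fin.sum_univ_four] at e0 e1 e2 e3
    funext k
    fin_cases k
    · exact e2.resolve_left (by norm_num)
    · exact e1
    · exact e3
    · exact e0

/-! ### Circles of parabolic fixed points -/

theorem pd_comp_withParam {f : (Fin 4 → ℝ) → ℝ} {y : Fin 3 → ℝ} {c : ℝ}
    (hf : DifferentiableAt ℝ f (withParam y c)) (i : Fin 3) :
    pd i (fun y' => f (withParam y' c)) y = pd i.castSucc f (withParam y c) := by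
  have hw : HasFDerivAt (fun y' => withParam y' c)
      (ContinuousLinearMap.pi ![ContinuousLinearMap.proj 0, ContinuousLinearMap.proj 1,
        ContinuousLinearMap.proj 2, 0] : (Fin 3 → ℝ) →L[ℝ] (Fin 4 → ℝ)) y := by
    rw [hasFDerivAt_pi']
    intro k
    fin_cases k
    · exact hasFDerivAt_apply 0 y
    · exact hasFDerivAt_apply 1 y
    · exact hasFDerivAt_apply 2 y
    · exact hasFDerivAt_const c y
  have hcomp : HasFDerivAt (fun y' => f (withParam y' c)) _ y := hf.hasFDerivAt.comp y hw
  rw [pd, pd, hcomp.fderiv, ContinuousLinearMap.comp_apply]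
  congr 1
  funext k
  fin_cases i <;> fin_cases k <;> rfl

theorem isParabolicCircle_iff (hU : IsOpen U) (H : SmoothFn U) (y : Fin 3 → ℝ) (c : ℝ)
    (hy : withParam y c ∈ U) : IsParabolicCircle (fun y' => H (withParam y' c)) y ↔
      withParam y c ∈ parabolicSet U H ∩ restSet U H := by
  have hcont : Continuous fun y' => withParam y' c := by
    refine continuous_pi fun k => ?_
    fin_cases k
    · exact continuous_apply 0
    · exact continuous_apply 1
    · exact continuous_apply 2
    · exact continuous_const
  have hO : IsOpen ((fun y' => withParam y' c) ⁻¹' U) := hU.preimage hcont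
  have h1 : ∀ i : Fin 3, ∀ y' ∈ (fun y' => withParam y' c) ⁻¹' U,
      pd i (fun y' => H (withParam y' c)) y' = pd i.castSucc H (withParam y' c) :=
    fun i y' hy' => pd_comp_withParam ((H.contDiffAt hU hy').differentiableAt (by simp)) i
  have h2 : ∀ i j : Fin 3, pd i (pd j fun y' => H (withParam y' c)) y =
      pd i.castSucc (pd j.castSucc H) (withParam y c) := by
    intro i j
    rw [pd_congr hO (h1 j) i y hy, pd_comp_withParam]
    exact ((H.contDiffOn_pd hU _).contDiffAt (hU.mem_nhds hy)).differentiableAt (by simp)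
  have hdet : normalHess (n := 1) (fun y' => H (withParam y' c)) y =
      normalHess (n := 2) H (withParam y c) := by
    simp only [normalHess]
    rw [h2, h2, h2, h2]
    rfl
  have hvf : ∀ θ : Real.Angle, hamVF (fun p => H (withParam p.1 c)) (y, θ) =
      ![pd 1 H (withParam y c), -pd 0 H (withParam y c), 0, pd 2 H (withParam y c)] := by
    intro θ
    simp only [hamVF]
    rw [h1 0 y hy, h1 1 y hy, h1 2 y hy, deriv_const, neg_zero]
    rfl
  rw [IsParabolicCircle, hdet]
  simp only [hvf, forall_const]
  simp [parabolicSet, fixedSet, restSet, fixEq]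
  tauto

/-- A singular symmetric 2×2 matrix has a nonzero diagonal entry or is zero, so the three excluded
cases are exhaustive. -/
theorem not_isParabolicCircle_of {Ω : Set (Fin 3 → ℝ)} (hΩ : IsOpen Ω) (h : SmoothFn Ω)
    {y : Fin 3 → ℝ} (hy : y ∈ Ω)
    (h1 : ¬ (pd 0 h y = 0 ∧ pd 1 h y = 0 ∧ pd 0 (pd 0 h) y = 0 ∧ pd 0 (pd 1 h) y = 0 ∧
      pd 1 (pd 1 h) y = 0))
    (h2 : pd 1 (pd 1 h) y ≠ 0 →
      ¬ (pd 0 h y = 0 ∧ pd 1 h y = 0 ∧ hessDet 0 1 h y = 0 ∧ pd 2 h y = 0))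
    (h3 : pd 0 (pd 0 h) y ≠ 0 →
      ¬ (pd 1 h y = 0 ∧ pd 0 h y = 0 ∧ hessDet 1 0 h y = 0 ∧ pd 2 h y = 0)) :
    ¬ IsParabolicCircle h y := by
  rintro ⟨hvf, hdet⟩
  have e1 : pd 1 h y = 0 := congrFun (hvf 0) 0
  have e0 : -pd 0 h y = 0 := congrFun (hvf 0) 1
  have e2 : pd 2 h y = 0 := congrFun (hvf 0) 3
  rw [neg_eq_zero] at e0
  rw [h.det_normalHess (n := 1) hΩ hy] at hdet
  by_cases g1 : pd 1 (pd 1 h) y = 0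
  · by_cases g0 : pd 0 (pd 0 h) y = 0
    · refine h1 ⟨e0, e1, g0, ?_, g1⟩
      rw [hessDet, g0, zero_mul, zero_sub, neg_eq_zero] at hdet
      exact pow_eq_zero_iff two_ne_zero |>.1 hdet
    · exact h3 g0 ⟨e1, e0, by rwa [h.hessDet_comm hΩ 1 0 hy], e2⟩
  · exact h2 g1 ⟨e0, e1, hdet, e2⟩

theorem isGeneric_not_isParabolicCircle {Ω : Set (Fin 3 → ℝ)} (hΩ : IsOpen Ω) :
    IsGeneric {h : SmoothFn Ω | ∀ y ∈ Ω, ¬ IsParabolicCircle h y} := by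
  have : BaireSpace (SmoothFn Ω) := baireSpace hΩ
  have hres : {h : SmoothFn Ω | ∀ y ∈ Ω, ¬ IsParabolicCircle h y} ∈ residual (SmoothFn Ω) := by
    filter_upwards [residual_hess_ne_zero hΩ (by norm_num) (i := 0) (j := 1) (by decide),
      residual_not_rest hΩ (by norm_num) (i := 0) (j := 1) (d := 2) (by decide) (by decide)
        (by decide),
      residual_not_rest hΩ (by norm_num) (i := 1) (j := 0) (d := 2) (by decide) (by decide)
        (by decide)] with h h1 h2 h3 y hy
    exact not_isParabolicCircle_of hΩ h hy (h1 ⟨y, hy⟩) (h2 ⟨y, hy⟩) (h3 ⟨y, hy⟩)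
  exact ⟨hres, dense_of_mem_residual hres⟩

/-! ### Generic families -/

/-- The genericity conditions in the chart `∂ⱼ²H ≠ 0`. -/
structure IsRegularChart (U : Set (Fin 4 → ℝ)) (i j : Fin 4) (H : (Fin 4 → ℝ) → ℝ) : Prop where
  grad : ∀ q : U, pd j (pd j H) q ≠ 0 → ¬ (pd i H q = 0 ∧ pd j H q = 0 ∧
    hessDet i j H q = 0 ∧ reducedGrad i j 2 H q = 0 ∧ reducedGrad i j 3 H q = 0)
  det : ∀ q : U, pd j (pd j H) q ≠ 0 → ¬ (pd i H q = 0 ∧ pd j H q = 0 ∧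
    hessDet i j H q = 0 ∧ reducedDet i j i H q = 0 ∧ reducedDet i j 2 H q = 0)
  proportional : ∀ q : U, pd j (pd j H) q * reducedDet i j 2 H q ≠ 0 →
    ¬ (pd i H q = 0 ∧ pd j H q = 0 ∧ hessDet i j H q = 0 ∧ reducedDet i j i H q = 0 ∧
      reducedGrad i j 2 H q * reducedDet i j 3 H q = reducedGrad i j 3 H q * reducedDet i j 2 H q)
  rest : ∀ q : U, pd j (pd j H) q ≠ 0 → ¬ (pd i H q = 0 ∧ pd j H q = 0 ∧
    hessDet i j H q = 0 ∧ pd 2 H q = 0 ∧ (restMatrix i j 2 H q).det = 0)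

theorem residual_isRegularChart (hU : IsOpen U) {i j : Fin 4} (hij : i ≠ j) (hi2 : i ≠ 2)
    (hj2 : j ≠ 2) (hi3 : i ≠ 3) (hj3 : j ≠ 3) :
    {H : SmoothFn U | IsRegularChart U i j H} ∈ residual (SmoothFn U) := by
  filter_upwards [residual_reducedGrad hU (by norm_num) hij hi2 hj2 hi3 hj3 (by decide),
    residual_reducedDet hU (by norm_num) hij hi2 hj2,
    residual_reduced_proportional hU (by norm_num) hij hi2 hi3 hj3 (by decide),
    residual_det_restMatrix hU hij hi2 hj2] with H h1 h2 h3 h4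
  exact ⟨h1, h2, h3, h4⟩

/-- Eliminating `b` through the `j`-th component leaves a relation between the reduced rows. If `c =
0`, then `a ≠ 0` contradicts `grad`; if `c ≠ 0`, the rows contradict `det` or `proportional`. -/
theorem IsRegularChart.eq_zero_of_relation (hU : IsOpen U) {H : SmoothFn U} {i j : Fin 4}
    (h : IsRegularChart U i j H) {q : Fin 4 → ℝ} (hq : q ∈ U) (hjj : pd j (pd j H) q ≠ 0)
    (hi : pd i H q = 0) (hj : pd j H q = 0) (hdet : hessDet i j H q = 0) {a b c : ℝ}
    (hrel : ∀ l, a * pd l (pd i H) q + b * pd l (pd j H) q + c * hessDetDeriv i j l H q = 0) :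
    a = 0 ∧ b = 0 ∧ c = 0 := by
  have rj := hrel j
  rw [pd_comm hU H.2 j i q hq] at rj
  have key : ∀ l, a * reducedGrad i j l H q + c * reducedDet i j l H q = 0 := by
    intro l
    rw [reducedGrad, reducedDet]
    linear_combination pd j (pd j H) q * hrel l - pd l (pd j H) q * rj
  -- In direction `i` the reduced gradient is the Hessian determinant itself.
  have hgi : reducedGrad i j i H q = 0 := by
    rw [reducedGrad]
    rw [hessDet] at hdet
    linear_combination hdet
  have ki := key i
  rw [hgi, mul_zero, zero_add] at ki
  by_cases hc : c = 0
  · subst hc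
    have ha : a = 0 := by
      by_contra ha
      have k2 := key 2
      have k3 := key 3
      simp only [zero_mul, add_zero, mul_eq_zero, ha, false_or] at k2 k3
      exact h.grad ⟨q, hq⟩ hjj ⟨hi, hj, hdet, k2, k3⟩
    subst ha
    refine ⟨rfl, ?_, rfl⟩
    simpa [hjj] using rj
  · exfalso
    have hs : reducedDet i j i H q = 0 := by simpa [hc] using ki
    by_cases hC : reducedDet i j 2 H q = 0
    · exact h.det ⟨q, hq⟩ hjj ⟨hi, hj, hdet, hs, hC⟩
    · refine h.proportional ⟨q, hq⟩ (mul_ne_zero hjj hC) ⟨hi, hj, hdet, hs, ?_⟩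
      refine mul_left_cancel₀ hc ?_
      change c * (reducedGrad i j 2 H q * reducedDet i j 3 H q) =
        c * (reducedGrad i j 3 H q * reducedDet i j 2 H q)
      linear_combination reducedGrad i j 2 H q * key 3 - reducedGrad i j 3 H q * key 2

theorem IsRegularChart.eq_zero_of_fderiv (hU : IsOpen U) {H : SmoothFn U} {i j : Fin 4}
    (h : IsRegularChart U i j H) {q : Fin 4 → ℝ} (hq : q ∈ U) (hjj : pd j (pd j H) q ≠ 0)
    (hi : pd i H q = 0) (hj : pd j H q = 0) (hdet : hessDet i j H q = 0) (h2 : pd 2 H q = 0)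
    {w : Fin 4 → ℝ} (wi : fderiv ℝ (pd i H) q w = 0) (wj : fderiv ℝ (pd j H) q w = 0)
    (wd : fderiv ℝ (hessDet i j H) q w = 0) (w2 : fderiv ℝ (pd 2 H) q w = 0) : w = 0 := by
  by_contra hw
  refine h.rest ⟨q, hq⟩ hjj ⟨hi, hj, hdet, h2, Matrix.exists_mulVec_eq_zero_iff.1 ⟨w, hw, ?_⟩⟩
  rw [H.restMatrix_mulVec hU i j 2 hq]
  funext k
  fin_cases k
  · exact wi
  · exact wj
  · exact wd
  · exact w2

/-- The charts `∂ᵥ²H ≠ 0` and `∂ₓ²H ≠ 0` cover `P`; symmetry of second derivatives carries the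
results of the second chart back to the order `(x, v)`. -/
theorem isTransverseFamily_of (hU : IsOpen U) (H : SmoothFn U)
    (hhess : ∀ q : U, ¬ (pd 0 H q = 0 ∧ pd 1 H q = 0 ∧ pd 0 (pd 0 H) q = 0 ∧
      pd 0 (pd 1 H) q = 0 ∧ pd 1 (pd 1 H) q = 0))
    (hT : ∀ q : U, ¬ (pd 2 H q = 0 ∧ ∀ l, pd l (pd 2 H) q = 0))
    (h01 : IsRegularChart U 0 1 H) (h10 : IsRegularChart U 1 0 H) : IsTransverseFamily U H := by
  have hP : ∀ q, q ∈ parabolicSet U H ↔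
      q ∈ U ∧ pd 0 H q = 0 ∧ pd 1 H q = 0 ∧ hessDet 0 1 H q = 0 := by
    intro q
    by_cases hq : q ∈ U
    · have := H.det_normalHess (n := 2) hU hq
      simp [parabolicSet, fixedSet, fixEq]
      rw [this]
      tauto
    · simp [parabolicSet, fixedSet, hq]
  have hchart : ∀ q ∈ parabolicSet U H, pd 0 (pd 0 H) q ≠ 0 ∨ pd 1 (pd 1 H) q ≠ 0 := by
    intro q hqP
    obtain ⟨hq, e0, e1, e2⟩ := (hP q).1 hqP
    by_contra! hne
    refine hhess ⟨q, hq⟩ ⟨e0, e1, hne.1, ?_, hne.2⟩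
    rw [hessDet, hne.1, zero_mul, zero_sub, neg_eq_zero] at e2
    exact pow_eq_zero_iff two_ne_zero |>.1 e2
  have hrel : ∀ q ∈ parabolicSet U H, ∀ a b c : ℝ,
      (∀ l, a * pd l (pd 0 H) q + b * pd l (pd 1 H) q + c * hessDetDeriv 0 1 l H q = 0) →
      a = 0 ∧ b = 0 ∧ c = 0 := by
    intro q hqP a b c hr
    obtain ⟨hq, e0, e1, e2⟩ := (hP q).1 hqP
    rcases hchart q hqP with hne | hne
    · obtain ⟨hb, ha, hc⟩ := h10.eq_zero_of_relation hU hq hne e1 e0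
        (by rwa [H.hessDet_comm hU 1 0 hq]) (a := b) (b := a) (c := c) fun l => by
          rw [H.hessDetDeriv_comm hU 1 0 l hq]
          linear_combination hr l
      exact ⟨ha, hb, hc⟩
    · exact h01.eq_zero_of_relation hU hq hne e0 e1 e2 hr
  have hregP : ∀ q ∈ parabolicSet U H, Function.Surjective (fderiv ℝ (parEq H) q) := by
    intro q hqP
    have hq := ((hP q).1 hqP).1
    refine surjective_fderiv_of_forall (H.differentiableAt_parEq hU hq) fun c hc => ?_
    obtain ⟨c0, c1, c2⟩ := hrel q hqP (c 0) (c 1) (c 2) fun l => by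
      have := hc l
      rw [Fin.sum_univ_three] at this
      have h2 : pd l (fun z => parEq H z 2) q = hessDetDeriv 0 1 l H q := by
        rw [← H.pd_hessDet hU 0 1 l hq]
        exact pd_congr hU (fun z hz => H.det_normalHess (n := 2) hU hz) l q hq
      rw [h2] at this
      exact this
    funext k
    fin_cases k
    · exact c0
    · exact c1
    · exact c2
  have hfix : ContDiffOn ℝ ∞ (fixEq H) U := by
    have h1 := H.contDiffOn_pd hU
    rw [contDiffOn_pi]
    intro k
    fin_cases k <;> simp [fixEq] <;> fun_prop
  have hregF : ∀ q ∈ fixedSet U H, Function.Surjective (fderiv ℝ (fixEq H) q) := by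
    intro q hqF
    have hq : q ∈ U := hqF.1
    refine surjective_fderiv_of_forall
      ((hfix.contDiffAt (hU.mem_nhds hq)).differentiableAt (by simp)) fun c hc => ?_
    have hc' : ∀ l, c 0 * pd l (pd 0 H) q + c 1 * pd l (pd 1 H) q = 0 := fun l => by
      have := hc l
      rw [Fin.sum_univ_two] at this
      exact this
    have hc01 : c 0 = 0 ∧ c 1 = 0 := by
      by_cases hdet : hessDet 0 1 H q = 0
      · have e0 : pd 0 H q = 0 := congrFun hqF.2 0
        have e1 : pd 1 H q = 0 := congrFun hqF.2 1
        obtain ⟨c0, c1, -⟩ := hrel q ((hP q).2 ⟨hq, e0, e1, hdet⟩) (c 0) (c 1) 0 fun l => by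
          rw [zero_mul, add_zero]
          exact hc' l
        exact ⟨c0, c1⟩
      -- Off `P` the Hessian block in `(x, v)` is invertible, and Cramer's rule gives `c = 0`.
      · have r0 := hc' 0
        have r1 := hc' 1
        rw [pd_comm hU H.2 1 0 q hq] at r1
        have k0 : c 0 * hessDet 0 1 H q = 0 := by
          rw [hessDet]
          linear_combination pd 1 (pd 1 H) q * r0 - pd 0 (pd 1 H) q * r1
        have k1 : c 1 * hessDet 0 1 H q = 0 := by
          rw [hessDet]
          linear_combination pd 0 (pd 0 H) q * r1 - pd 0 (pd 1 H) q * r0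
        exact ⟨(mul_eq_zero.1 k0).resolve_right hdet, (mul_eq_zero.1 k1).resolve_right hdet⟩
    funext k
    fin_cases k
    · exact hc01.1
    · exact hc01.2
  have hregT : ∀ q ∈ restSet U H, fderiv ℝ (pd 2 H) q ≠ 0 := by
    intro q hqT h0
    refine hT ⟨q, hqT.1⟩ ⟨hqT.2, fun l => ?_⟩
    change fderiv ℝ (pd 2 H) q _ = 0
    rw [h0]
    rfl
  have hinj : ∀ q ∈ parabolicSet U H ∩ restSet U H,
      Function.Injective (fderiv ℝ (restEq (n := 1) H) q) := by
    intro q hqPT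
    obtain ⟨hq, e0, e1, e2⟩ := (hP q).1 hqPT.1
    rw [injective_iff_map_eq_zero]
    intro w hw
    have hk := fun k => congrFun hw k
    simp only [fderiv_apply_coord (H.differentiableAt_restEq hU hq)] at hk
    have w0 : fderiv ℝ (pd 0 H) q w = 0 := hk 0
    have w1 : fderiv ℝ (pd 1 H) q w = 0 := hk 1
    have w2 : fderiv ℝ (hessDet 0 1 H) q w = 0 := hk 2
    have w3 : fderiv ℝ (pd 2 H) q w = 0 := hk 3
    rcases hchart q hqPT.1 with hne | hne
    · have hcomm : hessDet 1 0 H =ᶠ[𝓝 q] hessDet 0 1 H := by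
        filter_upwards [hU.mem_nhds hq] with z hz using H.hessDet_comm hU 1 0 hz
      exact h10.eq_zero_of_fderiv hU hq hne e1 e0 (by rwa [H.hessDet_comm hU 1 0 hq]) hqPT.2.2
        w1 w0 (by rwa [hcomm.fderiv_eq]) w3
    · exact h01.eq_zero_of_fderiv hU hq hne e0 e1 e2 hqPT.2.2 w0 w1 w2 w3
  have hiso : ∀ q ∈ parabolicSet U H ∩ restSet U H,
      ∃ W ∈ 𝓝 q, W ∩ (parabolicSet U H ∩ restSet U H) = {q} :=
    fun q hq => H.exists_nhds_inter_eq_singleton hU hq (hinj q hq)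
  have hd2 : ∀ q ∈ U, DifferentiableAt ℝ (fun z (_ : Fin 1) => pd 2 H z) q := fun q hq =>
    differentiableAt_pi.2 fun _ =>
      ((H.contDiffOn_pd hU 2).contDiffAt (hU.mem_nhds hq)).differentiableAt (by simp)
  refine ⟨isSubmanifold_of_regular (k := 2) (m := 2) rfl hU hfix rfl hregF, hregF,
    isSubmanifold_of_regular (k := 1) (m := 3) rfl hU (H.contDiffOn_parEq hU) ?_ hregP, hregP, ?_,
    isSubmanifold_of_regular (k := 3) (m := 1) rfl hU (g := fun z _ => pd 2 H z)
      (contDiffOn_pi.2 fun _ => H.contDiffOn_pd hU 2) ?_ ?_, hregT, ?_, hiso, ?_⟩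
  · ext q
    simp [parabolicSet, fixedSet, fixEq, parEq, and_assoc]
  · intro q hqP h0
    have e00 := congrFun (congrFun h0 0) 0
    have e11 := congrFun (congrFun h0 1) 1
    rcases hchart q hqP with hne | hne
    · exact hne e00
    · exact hne e11
  · ext q
    simp only [restSet, mem_sep_iff, funext_iff]
    simp
  · intro q hqT
    refine surjective_fderiv_of_forall (hd2 q hqT.1) fun c hc => ?_
    funext k
    fin_cases k
    by_contra hne
    refine hT ⟨q, hqT.1⟩ ⟨hqT.2, fun l => ?_⟩
    have := hc l
    rw [Fin.sum_univ_one] at this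
    exact (mul_eq_zero.1 this).resolve_left hne
  · exact fun q hq => (H.isTransverseParabolicPoint_of_injective hU hq (hinj q hq)).transverse
  · intro K hK hKU
    refine finite_of_isolated hK fun q hqK => ?_
    have hq := hKU hqK
    by_cases hqPT : q ∈ parabolicSet U H ∩ restSet U H
    · obtain ⟨W, hW, hW'⟩ := hiso q hqPT
      exact ⟨W, hW, by rw [hW']; exact finite_singleton q⟩
    -- A point of `K` outside `P ∩ T` has a neighbourhood missing `P ∩ T`, by continuity of
    -- `restEq`.
    · rw [H.mem_inter_iff_restEq hU hq] at hqPT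
      have hev := (H.differentiableAt_restEq hU hq).continuousAt.eventually_ne hqPT
      refine ⟨_, hev, ?_⟩
      convert finite_empty
      rw [eq_empty_iff_forall_notMem]
      rintro z ⟨hz, hzPT⟩
      exact hz ((H.mem_inter_iff_restEq hU hzPT.2.1).1 hzPT)

theorem isGeneric_isTransverseFamily (hU : IsOpen U) :
    IsGeneric {H : SmoothFn U | IsTransverseFamily U H} := by
  have : BaireSpace (SmoothFn U) := baireSpace hU
  have hres : {H : SmoothFn U | IsTransverseFamily U H} ∈ residual (SmoothFn U) := by
    filter_upwards [residual_hess_ne_zero hU (by norm_num) (i := 0) (j := 1) (by decide),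
      residual_regular_pd_two hU,
      residual_isRegularChart hU (i := 0) (j := 1) (by decide) (by decide) (by decide) (by decide)
        (by decide),
      residual_isRegularChart hU (i := 1) (j := 0) (by decide) (by decide) (by decide) (by decide)
        (by decide)] with H h1 h2 h3 h4
    exact isTransverseFamily_of hU H h1 h2 h3 h4
  exact ⟨hres, dense_of_mem_residual hres⟩

end SmoothFn

theorem lemma3 (U : Set (Fin 4 → ℝ)) (hU : IsOpen U) (Ω : Set (Fin 3 → ℝ)) (hΩ : IsOpen Ω) :
    -- the points of `P ∩ T` are exactly the parabolic circles of fixed points of the family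
    (∀ (H : SmoothFn U) (y : Fin 3 → ℝ) (c : ℝ), withParam y c ∈ U →
      (IsParabolicCircle (fun y' => H (withParam y' c)) y ↔
        withParam y c ∈ parabolicSet U H ∩ restSet U H)) ∧
    -- in a generic family, `P ∩ T` is a transverse intersection and consists of isolated points
    IsGeneric {H : SmoothFn U | IsTransverseFamily U H} ∧
    -- such points do occur, anywhere in the domain
    (∀ q ∈ U, ∃ H : SmoothFn U, IsTransverseParabolicPoint U H q) ∧
    -- and they persist, locally uniquely, in all nearby families
    (∀ (H : SmoothFn U) (q : Fin 4 → ℝ), IsTransverseParabolicPoint U H q →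
      ∀ V ∈ 𝓝 q, ∃ W ∈ 𝓝 q, W ⊆ V ∧ ∀ᶠ H' : SmoothFn U in 𝓝 H,
        ∃ q' ∈ W, IsTransverseParabolicPoint U H' q' ∧
          W ∩ (parabolicSet U H' ∩ restSet U H') = {q'}) ∧
    -- whereas a generic single system, without a parameter, has no parabolic circle of fixed points
    IsGeneric {h : SmoothFn Ω | ∀ y ∈ Ω, ¬ IsParabolicCircle h y} := 
  ⟨SmoothFn.isParabolicCircle_iff hU, SmoothFn.isGeneric_isTransverseFamily hU,
    fun _ hq => SmoothFn.exists_isTransverseParabolicPoint hU hq,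
    fun H _ h _ hV => H.exists_nhds_persist hU h hV,
    SmoothFn.isGeneric_not_isParabolicCircle hΩ⟩
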